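/- For a real number $\alpha$ that is not a negative integer let $H_\alpha=H_\alpha^{(1)}=\psi(\alpha+1)+\gamma$ and, for integers $s\ge 2$, $$H_\alpha^{(s)}=\frac{(-1)^{s-1}}{(s-1)!}\bigl(\psi^{(s-1)}(\alpha+1)-\psi^{(s-1)}(1)\bigr)$$ be the shifted harmonic numbers, where $\psi=\Gamma'/\Gamma$ and $\gamma$ is the Euler-Mascheroni constant. Let $k\neq r$ and $m$ be positive integers and put $N=\max\{k,r\}$. Then for every real $\alpha>N$ the series $$\sum_{n=1}^\infty\frac{H_{n+\alpha}^{(m)}}{(n+r)(n+k)},\quad \sum_{n=1}^\infty\frac{H_{n+\alpha}H_{n+\alpha}^{(2)}}{(n+r)(n+k)},\quad \sum_{n=1}^\infty\frac{H_{n+\alpha}^3}{(n+r)(n+k)},\quad \sum_{n=1}^\infty\frac{H_{n+\alpha}^2H_{n+\alpha}^{(2)}}{(n+r)(n+k)}$$ converge, and each of them can be expressed in terms of shifted harmonic numbers and zeta values in the following sense. There is a polynomial expression with rational coefficients, depending only on $k$, $r$ (and on $m$ for the first series), in finitely many of the quantities $\alpha$; $\frac1{\alpha-i}$ with integers $0\le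 i<N$; $H_{\alpha-i}^{(s)}$ with integers $0\le i\le N$ and $s\ge 1$; and $\zeta(s)$ with integers $s\ge2$, whose value at $\alpha$ is the sum of the series for all real $\alpha>N$. -/

import Mathlib

noncomputable section

/-- The real digamma function `ψ = Γ' / Γ`. -/
def psi : ℝ → ℝ := logDeriv Real.Gamma

/-- The generalized shifted harmonic number `H_α^{(m)}` of order `m ≥ 1`:
`H_α^{(1)} = ψ(α + 1) + γ`, and, for `m ≥ 2`,
`H_α^{(m)} = (-1)^{m-1} / (m-1)! * (ψ^{(m-1)}(α + 1) - ψ^{(m-1)}(1))`.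
The order `m = 0` is a dummy value. -/
def shiftedHarmonic : ℕ → ℝ → ℝ
  | 0, _ => 0
  | 1, α => psi (α + 1) + Real.eulerMascheroniConstant
  | m + 2, α => (-1) ^ (m + 1) / (Nat.factorial (m + 1) : ℝ) *
      (iteratedDeriv (m + 1) psi (α + 1) - iteratedDeriv (m + 1) psi 1)

/-- The real number `ζ(s)`, for an integer `s ≥ 2`. -/
def zetaValue (s : ℕ) : ℝ := (riemannZeta (s : ℂ)).re

/-- The functions of `α` that are closed forms in shifted harmonic numbers and zeta values, with
shifts `0, …, N`: the finite `ℚ`-linear combinations of products of the functions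
* `α` and `1 / (α - i)` for integers `0 ≤ i < N` (rational functions of `α`),
* `H_{α - i}^{(s)}` for integers `0 ≤ i ≤ N` and orders `s ≥ 1`,
* the constants `ζ(s)` for integers `s ≥ 2`.
They are used for `α > N`, where none of these functions has a singularity. -/
def closedForms (N : ℕ) : Subalgebra ℚ (ℝ → ℝ) :=
  Algebra.adjoin ℚ
    ({fun α : ℝ => α} ∪
     {f | ∃ i : ℕ, i < N ∧ f = fun α : ℝ => 1 / (α - (i : ℝ))} ∪
     {f | ∃ s i : ℕ, 1 ≤ s ∧ i ≤ N ∧ f = fun α : ℝ => shiftedHarmonic s (α - (i : ℝ))} ∪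
     {f | ∃ s : ℕ, 2 ≤ s ∧ f = fun _ : ℝ => zetaValue s})

end

/-! For r < k, 1/((n+r)(n+k)) is 1/(k-r) times the sum of 1/(n+i) - 1/(n+i+1) over r ≤ i < k.
Summation by parts with b = α - i > 0 then reduces each series, up to finitely many explicit terms,
to W(b) = ∑ (g(j+b) - g(j-1+b))/j over j ≥ 1 (`LogBounded.hasSum_mul_sub_succ`,
`closedForms.exists_hasSum_of_lt`). Put x = j + b. Expanding the increment of g by H_{x-1}^{(s)} =
H_x^{(s)} - 1/x^s and using 1/(jx) = (1/j - 1/x)/b leaves sums `weightedSum g b` = ∑ g(x)(1/j - 1/x)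
with simpler g, and tails ∑ q(x)/x².

These are found from a difference equation. Passing from b to b + 1 changes `weightedSum g` by
W(b+1) + g(b+1)/(b+1), where W is known from the previous stage. A polynomial G in shifted harmonic
numbers with the same increments differs from the sum by a 1-periodic function. All functions
involved vary slowly, so that difference is constant (`weightedSum_add_tail`, resting on
`SlowlyVarying.eq_apply_zero`).

Some weighted sums match such a G only after a tail is added, and the tail itself is not evaluated
for general b. The combinations needed (`mixedSum`, `quarticPart`) are those in which these tails
cancel. The remaining constants are Euler sums at b = 0, obtained by dividing an evaluated weighted
sum by b and letting b → 0. -/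

open Filter Topology Set

local notation "H" => shiftedHarmonic

/-! ### Slow variation and uniqueness for the difference equation -/

/-- The increments of `f` over any fixed distance tend to zero along the natural numbers. -/
def SlowlyVarying (f : ℝ → ℝ) : Prop :=
  ∀ b : ℝ, 0 ≤ b → Tendsto (fun n : ℕ => f (n + b) - f n) atTop (𝓝 0)

namespace SlowlyVarying

/-- By periodicity f(n + b) - f(n) is the constant sequence f(b) - f(0), and it tends to 0. -/
theorem eq_apply_zero {f : ℝ → ℝ} (hf : SlowlyVarying f)
    (hp : ∀ b : ℝ, 0 ≤ b → f (b + 1) = f b) {b : ℝ} (hb : 0 ≤ b) : f b = f 0 := by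
  have key : ∀ c : ℝ, 0 ≤ c → ∀ n : ℕ, f (n + c) = f c := by
    intro c hc n
    induction n with
    | zero => simp
    | succ n ih =>
      rw [← ih, ← hp (n + c) (by positivity)]
      congr 1
      push_cast
      ring
  have h := hf b hb
  have h2 : (fun n : ℕ => f (n + b) - f n) = fun _ => f b - f 0 := by
    funext n
    have := key 0 le_rfl n
    rw [add_zero] at this
    rw [key b hb n, this]
  rw [h2] at h
  have := tendsto_nhds_unique h tendsto_const_nhds
  linarith

theorem add {f g : ℝ → ℝ} (hf : SlowlyVarying f) (hg : SlowlyVarying g) :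
    SlowlyVarying (fun b => f b + g b) := fun b hb => by
  have := (hf b hb).add (hg b hb)
  rw [add_zero] at this
  exact this.congr fun n => by ring

theorem const_mul {f : ℝ → ℝ} (c : ℝ) (hf : SlowlyVarying f) :
    SlowlyVarying (fun b => c * f b) := fun b hb => by
  have := (hf b hb).const_mul c
  rw [mul_zero] at this
  exact this.congr fun n => by ring

theorem sub {f g : ℝ → ℝ} (hf : SlowlyVarying f) (hg : SlowlyVarying g) :
    SlowlyVarying (fun b => f b - g b) := fun b hb => by
  have := (hf b hb).sub (hg b hb)
  rw [sub_zero] at this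
  exact this.congr fun n => by ring

/-- Monotonicity squeezes the increment over b between 0 and the increment over the integer ⌈b⌉,
which is a sum of finitely many unit increments. -/
theorem of_monotoneOn {f : ℝ → ℝ} (hm : MonotoneOn f (Ici 0))
    (h : Tendsto (fun n : ℕ => f (n + 1) - f n) atTop (𝓝 0)) : SlowlyVarying f := by
  have key : ∀ k : ℕ, Tendsto (fun n : ℕ => f (n + k) - f n) atTop (𝓝 0) := by
    intro k
    induction k with
    | zero => simp
    | succ k ih =>
      have h1 : Tendsto (fun n : ℕ => f ((n + k : ℕ) + 1) - f ((n + k : ℕ) : ℝ)) atTop (𝓝 0) :=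
        h.comp (tendsto_add_atTop_nat k)
      have := h1.add ih
      rw [add_zero] at this
      refine this.congr fun n => ?_
      push_cast
      rw [add_assoc]
      ring
  intro b hb
  refine squeeze_zero (fun n => ?_) (fun n => ?_) (key ⌈b⌉₊)
  · exact sub_nonneg.2 (hm (mem_Ici.2 (by positivity)) (mem_Ici.2 (by positivity)) (by linarith))
  · have := hm (mem_Ici.2 (by positivity : (0 : ℝ) ≤ n + b))
      (mem_Ici.2 (by positivity : (0 : ℝ) ≤ n + ⌈b⌉₊)) (by linarith [Nat.le_ceil b])
    linarith

theorem tsum_tail (φ : ℝ → ℝ) :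
    SlowlyVarying (fun b => ∑' n : ℕ, φ (n + 1 + b)) := by
  have key : ∀ b : ℝ, 0 ≤ b →
      Tendsto (fun m : ℕ => ∑' n : ℕ, φ (n + 1 + (m + b))) atTop (𝓝 0) := by
    intro b hb
    -- No summability is needed: if the series diverges, every tail has the default value 0.
    refine (tendsto_sum_nat_add fun n : ℕ => φ (n + 1 + b)).congr fun m => ?_
    refine tsum_congr fun n => ?_
    congr 1
    push_cast
    ring
  intro b hb
  have h1 := (key b hb).sub (key 0 le_rfl)
  rw [sub_zero] at h1
  exact h1.congr fun n => by rw [add_zero]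

end SlowlyVarying

/-! ### Telescoping and the series behind the shifted harmonic numbers -/

theorem hasSum_sub_succ {f : ℕ → ℝ} (hs : Summable fun n => f n - f (n + 1))
    (h : Tendsto f atTop (𝓝 0)) : HasSum (fun n => f n - f (n + 1)) (f 0) := by
  rw [hs.hasSum_iff_tendsto_nat]
  have := h.const_sub (f 0)
  rw [sub_zero] at this
  exact this.congr fun n => (Finset.sum_range_sub' f n).symm

theorem tsum_shift_sub {φ : ℝ → ℝ} {b : ℝ} (h : Summable fun n : ℕ => φ (n + 1 + b)) :
    ∑' n : ℕ, φ (n + 1 + (b + 1)) = ∑' n : ℕ, φ (n + 1 + b) - φ (b + 1) := by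
  rw [h.tsum_eq_zero_add, Nat.cast_zero, zero_add, add_comm 1 b, add_sub_cancel_left]
  refine tsum_congr fun n => ?_
  congr 1
  push_cast
  ring

theorem summable_one_div_succ_pow {s : ℕ} (hs : 2 ≤ s) :
    Summable fun n : ℕ => 1 / ((n : ℝ) + 1) ^ s := by
  have := (summable_nat_add_iff 1).2 (Real.summable_one_div_nat_pow.2 (show 1 < s by omega))
  exact this.congr fun n => by push_cast; rfl

/-- One constant c serves for all y in a neighbourhood of b, as termwise differentiation requires.
-/
theorem exists_mul_succ_le {b : ℝ} (hb : -1 < b) :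
    ∃ c : ℝ, 0 < c ∧ c ≤ 1 ∧ c < 1 + b ∧
      ∀ y : ℝ, c - 1 < y → ∀ n : ℕ, c * ((n : ℝ) + 1) ≤ n + 1 + y := by
  refine ⟨min 1 ((1 + b) / 2), lt_min one_pos (by linarith), min_le_left _ _,
    (min_le_right _ _).trans_lt (by linarith), fun y hy n => ?_⟩
  have h1 := min_le_left (1 : ℝ) ((1 + b) / 2)
  have h2 : (0 : ℝ) ≤ n := n.cast_nonneg
  nlinarith

/-- The series `∑ 1 / (n + 1 + b) ^ s`. -/
noncomputable def hurwitzSum (s : ℕ) (b : ℝ) : ℝ := ∑' n : ℕ, 1 / ((n : ℝ) + 1 + b) ^ s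

/-- The series `∑ (1 / (n + 1) - 1 / (n + 1 + b))`. -/
noncomputable def harmonicSeries (b : ℝ) : ℝ := ∑' n : ℕ, (1 / ((n : ℝ) + 1) - 1 / ((n : ℝ) + 1 + b))

theorem summable_hurwitzSum {s : ℕ} (hs : 2 ≤ s) {b : ℝ} (hb : -1 < b) :
    Summable fun n : ℕ => 1 / ((n : ℝ) + 1 + b) ^ s := by
  obtain ⟨c, hc, -, hcb, h⟩ := exists_mul_succ_le hb
  refine Summable.of_nonneg_of_le (fun n => ?_) (fun n => ?_)
    ((summable_one_div_succ_pow hs).mul_left (1 / c ^ s))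
  · have : 0 < (n : ℝ) + 1 + b := by have : (0 : ℝ) ≤ n := n.cast_nonneg
                                     linarith
    positivity
  · rw [div_mul_div_comm, one_mul, ← mul_pow]
    exact one_div_le_one_div_of_le (by positivity)
      (pow_le_pow_left₀ (by positivity) (h b (by linarith) n) s)

theorem summable_harmonicSeries {b : ℝ} (hb : -1 < b) :
    Summable fun n : ℕ => 1 / ((n : ℝ) + 1) - 1 / ((n : ℝ) + 1 + b) := by
  obtain ⟨c, hc, -, hcb, h⟩ := exists_mul_succ_le hb
  refine Summable.of_norm_bounded (g := fun n : ℕ => |b| / c * (1 / ((n : ℝ) + 1) ^ 2))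
    ((summable_one_div_succ_pow le_rfl).mul_left _) fun n => ?_
  have h0 : (0 : ℝ) < n + 1 := by positivity
  have h1 := h b (by linarith) n
  have h2 : 0 < (n : ℝ) + 1 + b := lt_of_lt_of_le (by positivity) h1
  rw [Real.norm_eq_abs, show 1 / ((n : ℝ) + 1) - 1 / ((n : ℝ) + 1 + b)
    = b / (((n : ℝ) + 1) * (n + 1 + b)) by field_simp; ring, abs_div,
    abs_of_pos (mul_pos h0 h2), div_mul_div_comm, mul_one]
  refine div_le_div_of_nonneg_left (abs_nonneg _) (by positivity) ?_
  nlinarith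

theorem harmonicSeries_zero : harmonicSeries 0 = 0 := by simp [harmonicSeries]

theorem harmonicSeries_add_one {b : ℝ} (hb : -1 < b) :
    harmonicSeries (b + 1) = harmonicSeries b + 1 / (b + 1) := by
  have h1 := (summable_harmonicSeries (b := b + 1) (by linarith)).hasSum
  have h2 := (summable_harmonicSeries hb).hasSum
  have h3 := h1.sub h2
  have h4 : HasSum (fun n : ℕ => 1 / ((n : ℝ) + 1 + b) - 1 / (((n + 1 : ℕ) : ℝ) + 1 + b))
      (1 / (((0 : ℕ) : ℝ) + 1 + b)) := by
    refine hasSum_sub_succ (f := fun n : ℕ => 1 / ((n : ℝ) + 1 + b)) ?_ ?_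
    · refine h3.summable.congr fun n => ?_
      push_cast
      ring
    · refine Tendsto.congr (fun n => ?_) (tendsto_const_nhds.div_atTop
        (tendsto_atTop_add_const_right atTop (1 + b)
          (tendsto_natCast_atTop_atTop (R := ℝ))) : Tendsto (fun n : ℕ => 1 / ((n : ℝ) + (1 + b)))
          atTop (𝓝 0))
      rw [add_assoc]
  have h5 := h3.unique (h4.congr_fun fun n => ?_)
  · rw [← harmonicSeries, ← harmonicSeries] at h5
    rw [Nat.cast_zero, zero_add, add_comm 1 b] at h5
    linarith
  · push_cast
    ring

theorem harmonicSeries_monotoneOn : MonotoneOn harmonicSeries (Ioi (-1)) := by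
  intro a ha b hb hab
  rw [mem_Ioi] at ha hb
  refine (summable_harmonicSeries ha).tsum_le_tsum (fun n => ?_) (summable_harmonicSeries hb)
  have h1 : (0 : ℝ) ≤ n := n.cast_nonneg
  have := one_div_le_one_div_of_le (show 0 < (n : ℝ) + 1 + a by linarith)
    (show (n : ℝ) + 1 + a ≤ n + 1 + b by linarith)
  linarith

theorem hasDerivAt_hurwitzSum {s : ℕ} (hs : 2 ≤ s) {b : ℝ} (hb : -1 < b) :
    HasDerivAt (hurwitzSum s) (-(s : ℝ) * hurwitzSum (s + 1) b) b := by
  obtain ⟨c, hc, hc1, hcb, h⟩ := exists_mul_succ_le hb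
  have key := hasDerivAt_tsum_of_isPreconnected
    (u := fun n : ℕ => (s : ℝ) * (1 / c ^ (s + 1) * (1 / ((n : ℝ) + 1) ^ (s + 1))))
    (g := fun (n : ℕ) (y : ℝ) => 1 / ((n : ℝ) + 1 + y) ^ s)
    (g' := fun (n : ℕ) (y : ℝ) => -(s : ℝ) * (1 / ((n : ℝ) + 1 + y) ^ (s + 1)))
    (t := Ioi (c - 1)) (y₀ := b) (y := b)
    (((summable_one_div_succ_pow (show 2 ≤ s + 1 by omega)).mul_left _).mul_left _)
    isOpen_Ioi isPreconnected_Ioi ?_ ?_ (mem_Ioi.2 (by linarith)) (summable_hurwitzSum hs hb)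
    (mem_Ioi.2 (by linarith))
  · rw [tsum_mul_left] at key
    exact key
  · intro n y hy
    have h0 : 0 < (n : ℝ) + 1 + y := lt_of_lt_of_le (by positivity) (h y hy n)
    have h1 : HasDerivAt (fun y : ℝ => (n : ℝ) + 1 + y) 1 y := (hasDerivAt_id y).const_add _
    have h2 := (h1.fun_pow s).fun_inv (pow_pos h0 s).ne'
    simp only [one_div]
    refine h2.congr_deriv ?_
    obtain ⟨t, rfl⟩ : ∃ t, s = t + 1 := ⟨s - 1, by omega⟩
    simp only [Nat.add_sub_cancel]
    field_simp
    ring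
  · intro n y hy
    have h0 : 0 < (n : ℝ) + 1 + y := lt_of_lt_of_le (by positivity) (h y hy n)
    rw [norm_mul, norm_neg, Real.norm_natCast, Real.norm_of_nonneg (by positivity),
      div_mul_div_comm, one_mul, ← mul_pow]
    gcongr
    exact h y hy n

theorem hasDerivAt_harmonicSeries {b : ℝ} (hb : -1 < b) :
    HasDerivAt harmonicSeries (hurwitzSum 2 b) b := by
  obtain ⟨c, hc, hc1, hcb, h⟩ := exists_mul_succ_le hb
  refine hasDerivAt_tsum_of_isPreconnected
    (u := fun n : ℕ => 1 / c ^ 2 * (1 / ((n : ℝ) + 1) ^ 2))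
    (g := fun (n : ℕ) (y : ℝ) => 1 / ((n : ℝ) + 1) - 1 / ((n : ℝ) + 1 + y))
    (g' := fun (n : ℕ) (y : ℝ) => 1 / ((n : ℝ) + 1 + y) ^ 2)
    (t := Ioi (c - 1)) (y₀ := b) (y := b)
    ((summable_one_div_succ_pow le_rfl).mul_left _)
    isOpen_Ioi isPreconnected_Ioi ?_ ?_ (mem_Ioi.2 (by linarith)) (summable_harmonicSeries hb)
    (mem_Ioi.2 (by linarith))
  · intro n y hy
    have h0 : 0 < (n : ℝ) + 1 + y := lt_of_lt_of_le (by positivity) (h y hy n)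
    have h1 : HasDerivAt (fun y : ℝ => (n : ℝ) + 1 + y) 1 y := (hasDerivAt_id y).const_add _
    have h2 := (h1.inv h0.ne').const_sub (1 / ((n : ℝ) + 1))
    simp only [one_div] at h2 ⊢
    refine h2.congr_deriv ?_
    field_simp
  · intro n y hy
    have h0 : 0 < (n : ℝ) + 1 + y := lt_of_lt_of_le (by positivity) (h y hy n)
    rw [Real.norm_of_nonneg (by positivity), div_mul_div_comm, one_mul, ← mul_pow]
    gcongr
    exact h y hy n

/-! ### The digamma function as a series -/

theorem psi_eq_deriv {x : ℝ} (hx : 0 < x) : psi x = deriv (Real.log ∘ Real.Gamma) x := by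
  have hd : DifferentiableAt ℝ Real.Gamma x :=
    Real.differentiableAt_Gamma fun m => ((neg_nonpos.mpr m.cast_nonneg).trans_lt hx).ne'
  rw [Function.comp_def, deriv.log hd (Real.Gamma_pos_of_pos hx).ne', psi, logDeriv_apply]

theorem psi_monotoneOn : MonotoneOn psi (Ioi 0) := by
  have h : MonotoneOn (deriv (Real.log ∘ Real.Gamma)) (Ioi 0) := by
    refine Real.convexOn_log_Gamma.monotoneOn_deriv fun x hx => ?_
    have hx : 0 < x := by simpa using hx
    exact (Real.differentiableAt_Gamma fun m =>
      ((neg_nonpos.mpr m.cast_nonneg).trans_lt hx).ne').log (Real.Gamma_pos_of_pos hx).ne'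
  exact h.congr fun x hx => (psi_eq_deriv hx).symm

theorem psi_add_one {x : ℝ} (hx : 0 < x) : psi (x + 1) = psi x + 1 / x := by
  have hd : DifferentiableAt ℝ Real.Gamma x :=
    Real.differentiableAt_Gamma fun m => ((neg_nonpos.mpr m.cast_nonneg).trans_lt hx).ne'
  have hG := (Real.Gamma_pos_of_pos hx).ne'
  have h1 : HasDerivAt (fun y : ℝ => y * Real.Gamma y) (1 * Real.Gamma x + x * deriv Real.Gamma x) x :=
    (hasDerivAt_id x).mul hd.hasDerivAt
  have h2 : deriv Real.Gamma (x + 1) = Real.Gamma x + x * deriv Real.Gamma x := by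
    rw [← deriv_comp_add_const, ← one_mul (Real.Gamma x), ← h1.deriv]
    refine EventuallyEq.deriv_eq ?_
    filter_upwards [eventually_gt_nhds hx] with y hy using Real.Gamma_add_one hy.ne'
  rw [psi, logDeriv_apply, logDeriv_apply, h2, Real.Gamma_add_one hx.ne']
  field_simp
  ring

theorem psi_one : psi 1 = -Real.eulerMascheroniConstant := by
  rw [psi, logDeriv_apply, Real.hasDerivAt_Gamma_one.deriv, Real.Gamma_one, div_one]

theorem tendsto_one_div_natCast_add (c : ℝ) :
    Tendsto (fun n : ℕ => 1 / ((n : ℝ) + c)) atTop (𝓝 0) :=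
  tendsto_const_nhds.div_atTop
    (tendsto_atTop_add_const_right atTop c (tendsto_natCast_atTop_atTop (R := ℝ)))

/-- Both sides have the increment 1/(b+1) and are monotone (the left one by log-convexity of Γ), so
they vary slowly and differ by a constant, which is read off at b = 0. -/
theorem psi_add_one_eq_of_nonneg {b : ℝ} (hb : 0 ≤ b) :
    psi (b + 1) = -Real.eulerMascheroniConstant + harmonicSeries b := by
  have h1 : SlowlyVarying fun b => psi (b + 1) := by
    refine .of_monotoneOn (fun x hx y hy hxy => psi_monotoneOn ?_ ?_ (by linarith)) ?_
    · rw [mem_Ici] at hx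
      rw [mem_Ioi]
      linarith
    · rw [mem_Ici] at hy
      rw [mem_Ioi]
      linarith
    · refine (tendsto_one_div_natCast_add 1).congr fun n => ?_
      rw [psi_add_one (x := (n : ℝ) + 1) (by positivity)]
      ring
  have h2 : SlowlyVarying harmonicSeries := by
    refine .of_monotoneOn (harmonicSeries_monotoneOn.mono fun x hx => ?_) ?_
    · rw [mem_Ici] at hx
      rw [mem_Ioi]
      linarith
    · refine (tendsto_one_div_natCast_add 1).congr fun n => ?_
      have : (0 : ℝ) ≤ n := n.cast_nonneg
      rw [harmonicSeries_add_one (b := (n : ℝ)) (by linarith)]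
      ring
  have := (h1.sub h2).eq_apply_zero (fun c hc => ?_) hb
  · rw [zero_add, psi_one, harmonicSeries_zero] at this
    linarith
  · rw [psi_add_one (x := c + 1) (by linarith), harmonicSeries_add_one (by linarith)]
    ring

theorem psi_eq_harmonicSeries {x : ℝ} (hx : 0 < x) :
    psi x = -Real.eulerMascheroniConstant + harmonicSeries (x - 1) := by
  have h1 := psi_add_one_eq_of_nonneg hx.le
  have h2 := harmonicSeries_add_one (b := x - 1) (by linarith)
  rw [sub_add_cancel] at h2
  rw [psi_add_one hx, h2] at h1
  linarith

theorem iteratedDeriv_psi (m : ℕ) {x : ℝ} (hx : 0 < x) :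
    iteratedDeriv (m + 1) psi x =
      (-1) ^ m * (Nat.factorial (m + 1) : ℝ) * hurwitzSum (m + 2) (x - 1) := by
  induction m generalizing x with
  | zero =>
    have h1 : HasDerivAt (fun y : ℝ => -Real.eulerMascheroniConstant + harmonicSeries (y - 1))
        (hurwitzSum 2 (x - 1)) x :=
      ((hasDerivAt_harmonicSeries (b := x - 1) (by linarith)).comp_sub_const x 1).const_add _
    rw [zero_add, iteratedDeriv_one]
    simp only [pow_zero, Nat.factorial_one, Nat.cast_one, one_mul, mul_one, zero_add]
    rw [← h1.deriv]
    refine EventuallyEq.deriv_eq ?_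
    filter_upwards [eventually_gt_nhds hx] with y hy using psi_eq_harmonicSeries hy
  | succ m ih =>
    have h1 := ((hasDerivAt_hurwitzSum (s := m + 2) (by omega) (b := x - 1)
      (by linarith)).comp_sub_const x 1).const_mul ((-1) ^ m * (Nat.factorial (m + 1) : ℝ))
    rw [iteratedDeriv_succ]
    trans (-1) ^ m * (Nat.factorial (m + 1) : ℝ) *
        (-((m + 2 : ℕ) : ℝ) * hurwitzSum (m + 2 + 1) (x - 1))
    · rw [← h1.deriv]
      refine EventuallyEq.deriv_eq ?_
      filter_upwards [eventually_gt_nhds hx] with y hy using ih hy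
    · rw [Nat.factorial_succ (m + 1)]
      push_cast
      ring

theorem zetaValue_eq_hurwitzSum {s : ℕ} (hs : 2 ≤ s) : zetaValue s = hurwitzSum s 0 := by
  have h := zeta_eq_tsum_one_div_nat_add_one_cpow (s := (s : ℂ))
    (by rw [Complex.natCast_re]; exact_mod_cast hs)
  rw [zetaValue, h, hurwitzSum, ← Complex.ofReal_re (∑' n : ℕ, _), Complex.ofReal_tsum]
  congr 1
  refine tsum_congr fun n => ?_
  rw [Complex.cpow_natCast]
  push_cast
  rw [add_zero]

/-! ### Series, recurrence, monotonicity and derivative of H^{(s)} -/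

theorem shiftedHarmonic_one {b : ℝ} (hb : -1 < b) : shiftedHarmonic 1 b = harmonicSeries b := by
  rw [shiftedHarmonic, psi_eq_harmonicSeries (by linarith), add_sub_cancel_right]
  ring

theorem shiftedHarmonic_of_two_le {s : ℕ} (hs : 2 ≤ s) {b : ℝ} (hb : -1 < b) :
    shiftedHarmonic s b = zetaValue s - hurwitzSum s b := by
  obtain ⟨m, rfl⟩ : ∃ m, s = m + 2 := ⟨s - 2, by omega⟩
  rw [zetaValue_eq_hurwitzSum hs, shiftedHarmonic, iteratedDeriv_psi m (by linarith),
    iteratedDeriv_psi m one_pos, add_sub_cancel_right, sub_self]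
  have h1 : ((-1 : ℝ) ^ m) ^ 2 = 1 := by rw [← pow_mul, mul_comm, pow_mul]; norm_num
  have h2 : (Nat.factorial (m + 1) : ℝ) ≠ 0 := by positivity
  field_simp
  linear_combination (-hurwitzSum (m + 2) b + hurwitzSum (m + 2) 0) * h1

theorem hasSum_hurwitz {s : ℕ} (hs : 2 ≤ s) {b : ℝ} (hb : -1 < b) :
    HasSum (fun n : ℕ => 1 / ((n : ℝ) + 1 + b) ^ s) (zetaValue s - shiftedHarmonic s b) := by
  rw [shiftedHarmonic_of_two_le hs hb, sub_sub_cancel]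
  exact (summable_hurwitzSum hs hb).hasSum

theorem hasSum_shiftedHarmonic_one {b : ℝ} (hb : -1 < b) :
    HasSum (fun n : ℕ => 1 / ((n : ℝ) + 1) - 1 / ((n : ℝ) + 1 + b)) (shiftedHarmonic 1 b) := by
  rw [shiftedHarmonic_one hb]
  exact (summable_harmonicSeries hb).hasSum

theorem shiftedHarmonic_zero {s : ℕ} (hs : 1 ≤ s) : shiftedHarmonic s 0 = 0 := by
  obtain rfl | h := hs.eq_or_lt
  · rw [shiftedHarmonic_one (by norm_num), harmonicSeries_zero]
  · rw [shiftedHarmonic_of_two_le h (by norm_num), zetaValue_eq_hurwitzSum h, sub_self]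

theorem shiftedHarmonic_add_one {s : ℕ} (hs : 1 ≤ s) {b : ℝ} (hb : -1 < b) :
    shiftedHarmonic s (b + 1) = shiftedHarmonic s b + 1 / (b + 1) ^ s := by
  obtain rfl | h := hs.eq_or_lt
  · rw [shiftedHarmonic_one hb, shiftedHarmonic_one (by linarith), harmonicSeries_add_one hb,
      pow_one]
  · rw [shiftedHarmonic_of_two_le h hb, shiftedHarmonic_of_two_le h (by linarith)]
    have := tsum_shift_sub (φ := fun x => 1 / x ^ s) (summable_hurwitzSum h hb)
    rw [hurwitzSum, this, hurwitzSum]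
    ring

theorem shiftedHarmonic_monotoneOn {s : ℕ} (hs : 1 ≤ s) :
    MonotoneOn (shiftedHarmonic s) (Ioi (-1)) := by
  obtain rfl | h := hs.eq_or_lt
  · exact harmonicSeries_monotoneOn.congr fun b hb => (shiftedHarmonic_one hb).symm
  · intro a ha b hb hab
    rw [shiftedHarmonic_of_two_le h ha, shiftedHarmonic_of_two_le h hb]
    rw [mem_Ioi] at ha hb
    refine sub_le_sub_left ((summable_hurwitzSum h hb).tsum_le_tsum (fun n => ?_)
      (summable_hurwitzSum h ha)) _
    have h1 : (0 : ℝ) ≤ n := n.cast_nonneg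
    have h2 : 0 < (n : ℝ) + 1 + a := by linarith
    gcongr

theorem shiftedHarmonic_nonneg {s : ℕ} (hs : 1 ≤ s) {b : ℝ} (hb : 0 ≤ b) :
    0 ≤ shiftedHarmonic s b := by
  rw [← shiftedHarmonic_zero hs]
  exact shiftedHarmonic_monotoneOn hs (by norm_num) (mem_Ioi.2 (by linarith)) hb

theorem shiftedHarmonic_le_zetaValue {s : ℕ} (hs : 2 ≤ s) {b : ℝ} (hb : 0 ≤ b) :
    shiftedHarmonic s b ≤ zetaValue s := by
  rw [← sub_nonneg]
  exact (hasSum_hurwitz hs (by linarith)).nonneg fun n => by positivity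

theorem hasDerivAt_shiftedHarmonic {s : ℕ} (hs : 1 ≤ s) {b : ℝ} (hb : -1 < b) :
    HasDerivAt (shiftedHarmonic s) (s * (zetaValue (s + 1) - shiftedHarmonic (s + 1) b)) b := by
  rw [shiftedHarmonic_of_two_le (show 2 ≤ s + 1 by omega) hb, sub_sub_cancel]
  obtain rfl | h := hs.eq_or_lt
  · have := hasDerivAt_harmonicSeries hb
    rw [Nat.cast_one, one_mul]
    refine this.congr_of_eventuallyEq ?_
    filter_upwards [eventually_gt_nhds hb] with y hy using shiftedHarmonic_one hy
  · have := (hasDerivAt_hurwitzSum h hb).const_sub (zetaValue s)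
    refine (this.congr_of_eventuallyEq ?_).congr_deriv (by ring)
    filter_upwards [eventually_gt_nhds hb] with y hy using shiftedHarmonic_of_two_le h hy

theorem shiftedHarmonic_one_natCast (n : ℕ) : shiftedHarmonic 1 n = (harmonic n : ℝ) := by
  induction n with
  | zero => simp [shiftedHarmonic_zero]
  | succ n ih =>
    have : (0 : ℝ) ≤ n := n.cast_nonneg
    rw [Nat.cast_succ, shiftedHarmonic_add_one le_rfl (by linarith), ih, harmonic_succ]
    push_cast
    rw [pow_one, one_div]

/-! ### Logarithmic growth and convergence -/

/-- The harmonic numbers grow more slowly than any power. -/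
theorem exists_shiftedHarmonic_one_pow_le (p : ℕ) {b : ℝ} (hb : 0 ≤ b) :
    ∃ C : ℝ, 0 < C ∧
      ∀ n : ℕ, (1 + shiftedHarmonic 1 (n + 1 + b)) ^ p ≤ C * ((n : ℝ) + 1) ^ (1 / 4 : ℝ) := by
  have hB : (0 : ℝ) ≤ Real.log (1 + ⌈b⌉₊) :=
    Real.log_nonneg (by linarith [(⌈b⌉₊).cast_nonneg (α := ℝ)])
  -- Chosen so that ε p ≤ 1/4; the logarithm is bounded by a multiple of the power ε.
  set ε : ℝ := 1 / (4 * (p + 1)) with hε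
  have hε0 : 0 < ε := by positivity
  refine ⟨(2 + Real.log (1 + ⌈b⌉₊) + 1 / ε) ^ p, by positivity, fun n => ?_⟩
  have hn : (0 : ℝ) ≤ n := n.cast_nonneg
  -- Rounding b up to an integer makes the logarithmic bound for ordinary harmonic numbers
  -- available.
  have h1 : shiftedHarmonic 1 (n + 1 + b) ≤ shiftedHarmonic 1 ((n + 1 + ⌈b⌉₊ : ℕ) : ℝ) := by
    refine shiftedHarmonic_monotoneOn le_rfl (mem_Ioi.2 (by linarith)) (mem_Ioi.2 ?_) ?_
    · push_cast
      linarith [(⌈b⌉₊).cast_nonneg (α := ℝ)]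
    · push_cast
      linarith [Nat.le_ceil b]
  rw [shiftedHarmonic_one_natCast] at h1
  have h2 := harmonic_le_one_add_log (n + 1 + ⌈b⌉₊)
  have h3 : Real.log ((n + 1 + ⌈b⌉₊ : ℕ) : ℝ) ≤ Real.log (n + 1) + Real.log (1 + ⌈b⌉₊) := by
    rw [← Real.log_mul (by positivity) (by positivity)]
    refine Real.log_le_log (by positivity) ?_
    push_cast
    nlinarith [mul_nonneg hn (⌈b⌉₊).cast_nonneg (α := ℝ)]
  have h4 := Real.log_le_rpow_div (x := (n : ℝ) + 1) (by linarith) hε0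
  have h5 : (1 : ℝ) ≤ ((n : ℝ) + 1) ^ ε := Real.one_le_rpow (by linarith) hε0.le
  have h6 : 1 + shiftedHarmonic 1 (n + 1 + b) ≤
      (2 + Real.log (1 + ⌈b⌉₊) + 1 / ε) * ((n : ℝ) + 1) ^ ε := by
    rw [div_eq_mul_one_div, mul_comm] at h4
    nlinarith [mul_nonneg hB (sub_nonneg.2 h5)]
  have h7 := shiftedHarmonic_nonneg le_rfl (show 0 ≤ (n : ℝ) + 1 + b by linarith)
  refine (pow_le_pow_left₀ (by linarith) h6 p).trans ?_
  rw [mul_pow]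
  refine mul_le_mul_of_nonneg_left ?_ (by positivity)
  rw [← Real.rpow_natCast, ← Real.rpow_mul (by linarith)]
  refine Real.rpow_le_rpow_of_exponent_le (by linarith) ?_
  rw [hε, one_div_mul_eq_div, div_le_div_iff₀ (by positivity) (by norm_num)]
  linarith

/-- On `[1, ∞)` the function `g` is bounded by a multiple of a power of `1 + H_x`. -/
def LogBounded (g : ℝ → ℝ) : Prop :=
  ∃ (p : ℕ) (C : ℝ), 0 ≤ C ∧ ∀ x : ℝ, 1 ≤ x → |g x| ≤ C * (1 + H 1 x) ^ p

namespace LogBounded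

theorem one_le {x : ℝ} (hx : 1 ≤ x) : 1 ≤ 1 + H 1 x := by
  linarith [shiftedHarmonic_nonneg le_rfl (show 0 ≤ x by linarith)]

theorem of_bounded {g : ℝ → ℝ} (C : ℝ) (h : ∀ x : ℝ, 1 ≤ x → |g x| ≤ C) : LogBounded g :=
  ⟨0, C, (abs_nonneg _).trans (h 1 le_rfl), fun x hx => by simpa using h x hx⟩

theorem const (c : ℝ) : LogBounded fun _ => c := of_bounded |c| fun _ _ => le_rfl

theorem one_div_pow (s : ℕ) : LogBounded fun x => 1 / x ^ s :=
  of_bounded 1 fun x hx => by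
    rw [abs_of_nonneg (by positivity)]
    exact div_le_one_of_le₀ (one_le_pow₀ hx) (by positivity)

theorem shiftedHarmonic {s : ℕ} (hs : 1 ≤ s) : LogBounded (H s) := by
  obtain rfl | h := hs.eq_or_lt
  · refine ⟨1, 1, one_pos.le, fun x hx => ?_⟩
    have := one_le hx
    rw [abs_of_nonneg (by linarith)]
    linarith
  · refine of_bounded (zetaValue s) fun x hx => ?_
    rw [abs_of_nonneg (shiftedHarmonic_nonneg hs (by linarith))]
    exact shiftedHarmonic_le_zetaValue h (by linarith)

theorem add {f g : ℝ → ℝ} (hf : LogBounded f) (hg : LogBounded g) :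
    LogBounded fun x => f x + g x := by
  obtain ⟨p, C, hC, h1⟩ := hf
  obtain ⟨q, D, hD, h2⟩ := hg
  refine ⟨p + q, C + D, by positivity, fun x hx => (abs_add_le _ _).trans ?_⟩
  have h := one_le hx
  rw [add_mul]
  refine add_le_add ((h1 x hx).trans ?_) ((h2 x hx).trans ?_)
  · exact mul_le_mul_of_nonneg_left (pow_le_pow_right₀ h (by omega)) hC
  · exact mul_le_mul_of_nonneg_left (pow_le_pow_right₀ h (by omega)) hD

theorem mul {f g : ℝ → ℝ} (hf : LogBounded f) (hg : LogBounded g) :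
    LogBounded fun x => f x * g x := by
  obtain ⟨p, C, hC, h1⟩ := hf
  obtain ⟨q, D, hD, h2⟩ := hg
  refine ⟨p + q, C * D, by positivity, fun x hx => ?_⟩
  have h := one_le hx
  rw [abs_mul, pow_add, mul_mul_mul_comm]
  exact mul_le_mul (h1 x hx) (h2 x hx) (abs_nonneg _) (by positivity)

theorem sub {f g : ℝ → ℝ} (hf : LogBounded f) (hg : LogBounded g) :
    LogBounded fun x => f x - g x := by
  simpa only [neg_one_mul, ← sub_eq_add_neg] using hf.add ((const (-1)).mul hg)

theorem pow {f : ℝ → ℝ} (hf : LogBounded f) (k : ℕ) : LogBounded fun x => f x ^ k := by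
  induction k with
  | zero => simpa using const 1
  | succ k ih => simpa [pow_succ] using ih.mul hf

theorem div_pow {f : ℝ → ℝ} (hf : LogBounded f) (k : ℕ) : LogBounded fun x => f x / x ^ k := by
  simpa only [mul_one_div] using hf.mul (one_div_pow k)

theorem div {f : ℝ → ℝ} (hf : LogBounded f) : LogBounded fun x => f x / x := by
  simpa using hf.div_pow 1

theorem exists_abs_le {g : ℝ → ℝ} (hg : LogBounded g) {b : ℝ} (hb : 0 ≤ b) :
    ∃ C : ℝ, 0 < C ∧ ∀ c : ℝ, 0 ≤ c → c ≤ b → ∀ n : ℕ,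
      |g (n + 1 + c)| ≤ C * ((n : ℝ) + 1) ^ (1 / 4 : ℝ) := by
  obtain ⟨p, C, hC, h⟩ := hg
  obtain ⟨D, hD, h'⟩ := exists_shiftedHarmonic_one_pow_le p hb
  refine ⟨(C + 1) * D, by positivity, fun c hc hcb n => ?_⟩
  have hn : (0 : ℝ) ≤ n := n.cast_nonneg
  have h1 := h (n + 1 + c) (by linarith)
  have h2 := one_le (show (1 : ℝ) ≤ n + 1 + c by linarith)
  have h3 : H 1 (n + 1 + c) ≤ H 1 (n + 1 + b) :=
    shiftedHarmonic_monotoneOn le_rfl (mem_Ioi.2 (by linarith)) (mem_Ioi.2 (by linarith))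
      (by linarith)
  have h4 := pow_le_pow_left₀ (by linarith) (show 1 + H 1 (n + 1 + c) ≤ 1 + H 1 (n + 1 + b)
    by linarith) p
  have h5 : 0 ≤ (1 + H 1 (n + 1 + c)) ^ p := by positivity
  calc |g (n + 1 + c)| ≤ C * (1 + H 1 (n + 1 + c)) ^ p := h1
    _ ≤ (C + 1) * (1 + H 1 (n + 1 + c)) ^ p := by linarith
    _ ≤ (C + 1) * (D * ((n : ℝ) + 1) ^ (1 / 4 : ℝ)) :=
        mul_le_mul_of_nonneg_left (h4.trans (h' n)) (by positivity)
    _ = _ := by ring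

theorem summable_rpow : Summable fun n : ℕ => ((n : ℝ) + 1) ^ (1 / 4 : ℝ) / ((n : ℝ) + 1) ^ 2 := by
  have h := (summable_nat_add_iff 1).2
    (Real.summable_nat_rpow.2 (show (-(7 / 4) : ℝ) < -1 by norm_num))
  refine h.congr fun n => ?_
  have : (0 : ℝ) < n + 1 := by positivity
  push_cast
  rw [show (-(7 / 4) : ℝ) = 1 / 4 - (2 : ℕ) by norm_num, Real.rpow_sub_natCast this.ne']

theorem summable {g : ℝ → ℝ} (hg : LogBounded g) {b : ℝ} (hb : 0 ≤ b) {f : ℕ → ℝ} (K : ℝ)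
    (hf : ∀ n : ℕ, |f n| ≤ K * (|g (n + 1 + b)| / ((n : ℝ) + 1) ^ 2)) : Summable f := by
  obtain ⟨C, hC, h⟩ := hg.exists_abs_le hb
  refine Summable.of_norm_bounded (summable_rpow.mul_left (|K| * C)) fun n => (hf n).trans ?_
  have h1 := h b hb le_rfl n
  calc K * (|g (n + 1 + b)| / ((n : ℝ) + 1) ^ 2)
      ≤ |K| * (|g (n + 1 + b)| / ((n : ℝ) + 1) ^ 2) :=
        mul_le_mul_of_nonneg_right (le_abs_self K) (by positivity)
    _ ≤ |K| * (C * ((n : ℝ) + 1) ^ (1 / 4 : ℝ) / ((n : ℝ) + 1) ^ 2) := by gcongr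
    _ = _ := by ring

theorem summable_div_sq {g : ℝ → ℝ} (hg : LogBounded g) {b : ℝ} (hb : 0 ≤ b) :
    Summable fun n : ℕ => g (n + 1 + b) / ((n : ℝ) + 1 + b) ^ 2 := by
  refine hg.summable hb 1 fun n => ?_
  rw [abs_div, abs_of_nonneg (by positivity : (0 : ℝ) ≤ (n + 1 + b) ^ 2), one_mul]
  exact div_le_div_of_nonneg_left (abs_nonneg _) (by positivity)
    (pow_le_pow_left₀ (by positivity) (by linarith) 2)

theorem summable_div_mul {g : ℝ → ℝ} (hg : LogBounded g) {b : ℝ} (hb : 0 ≤ b) :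
    Summable fun n : ℕ => g (n + 1 + b) / (((n : ℝ) + 1) * ((n : ℝ) + 1 + b)) := by
  refine hg.summable hb 1 fun n => ?_
  rw [abs_div, abs_of_nonneg (by positivity : (0 : ℝ) ≤ (n + 1) * (n + 1 + b)), one_mul]
  gcongr
  nlinarith [n.cast_nonneg (α := ℝ)]

theorem tendsto_div {g : ℝ → ℝ} (hg : LogBounded g) {b : ℝ} (hb : 0 ≤ b) :
    Tendsto (fun n : ℕ => g (n + 1 + b) / ((n : ℝ) + 1)) atTop (𝓝 0) := by
  obtain ⟨C, hC, h⟩ := hg.exists_abs_le hb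
  have h1 : Tendsto (fun n : ℕ => C * ((n : ℝ) + 1) ^ (-(3 / 4) : ℝ)) atTop (𝓝 (C * 0)) := by
    refine Tendsto.const_mul C ?_
    exact (tendsto_rpow_neg_atTop (show (0 : ℝ) < 3 / 4 by norm_num)).comp
      (tendsto_atTop_add_const_right atTop 1 (tendsto_natCast_atTop_atTop (R := ℝ)))
  rw [mul_zero] at h1
  refine squeeze_zero_norm (fun n => ?_) h1
  have hn : (0 : ℝ) < n + 1 := by positivity
  rw [norm_div, Real.norm_eq_abs, Real.norm_of_nonneg hn.le, div_le_iff₀ hn, mul_assoc,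
    ← Real.rpow_add_one hn.ne', show (-(3 / 4) : ℝ) + 1 = 1 / 4 by norm_num]
  exact h b hb le_rfl n

theorem tendsto_div' {g : ℝ → ℝ} (hg : LogBounded g) {b : ℝ} (hb : 0 ≤ b) :
    Tendsto (fun n : ℕ => g (n + 1 + b) / ((n : ℝ) + 1 + b)) atTop (𝓝 0) := by
  have h0 := (hg.tendsto_div hb).norm
  rw [norm_zero] at h0
  refine squeeze_zero_norm (fun n => ?_) h0
  rw [norm_div, Real.norm_of_nonneg (by positivity : (0 : ℝ) ≤ n + 1 + b), norm_div,
    Real.norm_of_nonneg (by positivity : (0 : ℝ) ≤ n + 1)]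
  exact div_le_div_of_nonneg_left (norm_nonneg _) (by positivity) (by linarith)

/-- Dominated convergence; `exists_abs_le` supplies one bound for all shifts in [0, 1]. -/
theorem tendsto_tsum {g : ℝ → ℝ} (hg : LogBounded g)
    (hc : ∀ n : ℕ, ContinuousAt g (n + 1)) :
    Tendsto (fun b : ℝ => ∑' n : ℕ, g (n + 1 + b) / (((n : ℝ) + 1) * ((n : ℝ) + 1 + b)))
      (𝓝[>] 0) (𝓝 (∑' n : ℕ, g (n + 1) / ((n : ℝ) + 1) ^ 2)) := by
  obtain ⟨C, hC, h⟩ := hg.exists_abs_le zero_le_one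
  refine tendsto_tsum_of_dominated_convergence
    (bound := fun n : ℕ => C * (((n : ℝ) + 1) ^ (1 / 4 : ℝ) / ((n : ℝ) + 1) ^ 2))
    (summable_rpow.mul_left C) (fun n => ?_) ?_
  · have h1 : ContinuousAt (fun b : ℝ => g (n + 1 + b) / (((n : ℝ) + 1) * ((n : ℝ) + 1 + b))) 0 := by
      refine ContinuousAt.div ?_ (by fun_prop) (by positivity)
      refine ContinuousAt.comp (g := g) ?_ (by fun_prop)
      simpa using hc n
    have h2 := h1.tendsto.mono_left (nhdsWithin_le_nhds (s := Ioi 0))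
    simpa [sq] using h2
  · have h1 : Ioo (0 : ℝ) 1 ∈ 𝓝[>] (0 : ℝ) := Ioo_mem_nhdsGT one_pos
    filter_upwards [h1] with b hb n
    have h2 := h b hb.1.le hb.2.le n
    have h3 : (0 : ℝ) < n + 1 + b := by have := hb.1; positivity
    rw [norm_div, Real.norm_eq_abs, Real.norm_of_nonneg (by positivity), ← mul_div_assoc]
    have h4 : ((n : ℝ) + 1) ^ 2 ≤ (n + 1) * (n + 1 + b) := by nlinarith [hb.1, n.cast_nonneg (α := ℝ)]
    gcongr

end LogBounded

theorem SlowlyVarying.of_logBounded {f q : ℝ → ℝ} (hm : MonotoneOn f (Ici 0)) (hq : LogBounded q)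
    (h : ∀ b : ℝ, 0 ≤ b → f (b + 1) - f b = q (b + 1) / (b + 1)) : SlowlyVarying f := by
  refine .of_monotoneOn hm ((hq.tendsto_div le_rfl).congr fun n => ?_)
  rw [h n n.cast_nonneg, add_zero]

/-! ### Weighted sums and their difference equation -/

/-- The sum `∑ g (n + b) (1 / n - 1 / (n + b))` over `n ≥ 1`. -/
noncomputable def weightedSum (g : ℝ → ℝ) (b : ℝ) : ℝ :=
  ∑' n : ℕ, g (n + 1 + b) * (1 / ((n : ℝ) + 1) - 1 / ((n : ℝ) + 1 + b))

theorem LogBounded.summable_weightedSum {g : ℝ → ℝ} (hg : LogBounded g) {b : ℝ} (hb : 0 ≤ b) :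
    Summable fun n : ℕ => g (n + 1 + b) * (1 / ((n : ℝ) + 1) - 1 / ((n : ℝ) + 1 + b)) := by
  refine ((hg.summable_div_mul hb).mul_left b).congr fun n => ?_
  have h1 : (0 : ℝ) < n + 1 + b := by positivity
  field_simp
  ring

theorem LogBounded.hasSum_div_mul {g : ℝ → ℝ} (hg : LogBounded g) {b : ℝ} (hb : 0 < b) :
    HasSum (fun n : ℕ => g (n + 1 + b) / (((n : ℝ) + 1) * ((n : ℝ) + 1 + b)))
      (weightedSum g b / b) := by
  refine ((hg.summable_weightedSum hb.le).hasSum.div_const b).congr_fun fun n => ?_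
  have h1 : (0 : ℝ) < n + 1 + b := by positivity
  field_simp
  ring

theorem weightedSum_zero (g : ℝ → ℝ) : weightedSum g 0 = 0 := by simp [weightedSum]

theorem weightedSum_monotoneOn {g : ℝ → ℝ} (hg : LogBounded g) (hm : MonotoneOn g (Ici 0))
    (h0 : ∀ x : ℝ, 0 ≤ x → 0 ≤ g x) : MonotoneOn (weightedSum g) (Ici 0) := by
  intro a ha b hb hab
  rw [mem_Ici] at ha hb
  refine (hg.summable_weightedSum ha).tsum_le_tsum (fun n => ?_) (hg.summable_weightedSum hb)
  have h1 : (0 : ℝ) < n + 1 := by positivity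
  refine mul_le_mul (hm (mem_Ici.2 (by positivity)) (mem_Ici.2 (by positivity)) (by linarith))
    (sub_le_sub_left (one_div_le_one_div_of_le (by positivity) (by linarith)) _)
    (sub_nonneg.2 (one_div_le_one_div_of_le h1 (by linarith))) (h0 _ (by positivity))

/-- The increments of `weightedSum g` in terms of those of `g`. -/
theorem LogBounded.weightedSum_add_one {g : ℝ → ℝ} (hg : LogBounded g) {b W : ℝ} (hb : 0 ≤ b)
    (hW : HasSum (fun n : ℕ => (g (n + 1 + (b + 1)) - g (n + 1 + b)) / ((n : ℝ) + 1)) W) :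
    weightedSum g (b + 1) = weightedSum g b + W + g (b + 1) / (b + 1) := by
  have h1 := (hg.summable_weightedSum (b := b + 1) (by linarith)).hasSum
  have h2 := (hg.summable_weightedSum hb).hasSum
  have h3 := (h1.sub h2).sub hW
  -- After the increments of g are removed, what is left of the difference of the two sums
  -- telescopes in g(x)/x.
  obtain ⟨φ, hφ⟩ : ∃ φ : ℕ → ℝ, φ = fun n : ℕ => g (n + 1 + b) / ((n : ℝ) + 1 + b) := ⟨_, rfl⟩
  have h4 : ∀ n : ℕ, φ n - φ (n + 1) =
      g (n + 1 + (b + 1)) * (1 / ((n : ℝ) + 1) - 1 / ((n : ℝ) + 1 + (b + 1))) -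
        g (n + 1 + b) * (1 / ((n : ℝ) + 1) - 1 / ((n : ℝ) + 1 + b)) -
        (g (n + 1 + (b + 1)) - g (n + 1 + b)) / ((n : ℝ) + 1) := by
    intro n
    simp only [hφ]
    rw [show ((n + 1 : ℕ) : ℝ) + 1 + b = n + 1 + (b + 1) by push_cast; ring]
    ring
  have h5 := hasSum_sub_succ (f := φ) (h3.summable.congr fun n => (h4 n).symm) (hφ ▸ hg.tendsto_div' hb)
  have h6 := h3.unique (h5.congr_fun fun n => (h4 n).symm)
  have h7 : φ 0 = g (b + 1) / (b + 1) := by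
    simp only [hφ]
    rw [Nat.cast_zero, zero_add, add_comm 1 b]
  rw [h7] at h6
  simp only [weightedSum]
  linarith

theorem monotoneOn_mul {f g : ℝ → ℝ} (hf : MonotoneOn f (Ici 0)) (hg : MonotoneOn g (Ici 0))
    (hf0 : ∀ x : ℝ, 0 ≤ x → 0 ≤ f x) (hg0 : ∀ x : ℝ, 0 ≤ x → 0 ≤ g x) :
    MonotoneOn (fun x => f x * g x) (Ici 0) := fun a ha b hb hab =>
  mul_le_mul (hf ha hb hab) (hg ha hb hab) (hg0 a ha) (hf0 b hb)

theorem shiftedHarmonic_monotoneOn_Ici {s : ℕ} (hs : 1 ≤ s) : MonotoneOn (H s) (Ici 0) :=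
  (shiftedHarmonic_monotoneOn hs).mono fun x hx => by
    rw [mem_Ici] at hx
    exact mem_Ioi.2 (by linarith)

theorem shiftedHarmonic_pow_monotoneOn (k : ℕ) {s : ℕ} (hs : 1 ≤ s) :
    MonotoneOn (fun x => H s x ^ k) (Ici 0) := fun _ ha _ hb hab =>
  pow_le_pow_left₀ (shiftedHarmonic_nonneg hs ha) (shiftedHarmonic_monotoneOn_Ici hs ha hb hab) k

theorem shiftedHarmonic_eq_sub {s : ℕ} (hs : 1 ≤ s) {b : ℝ} (hb : 0 ≤ b) :
    H s b = H s (b + 1) - 1 / (b + 1) ^ s := by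
  rw [shiftedHarmonic_add_one hs (by linarith), add_sub_cancel_right]

/-! ### Slow variation of the monomials in the closed forms -/

namespace SlowlyVarying

theorem shiftedHarmonic {s : ℕ} (hs : 1 ≤ s) : SlowlyVarying (H s) := by
  refine .of_logBounded (q := fun x => 1 / x ^ (s - 1)) (shiftedHarmonic_monotoneOn_Ici hs)
    (.one_div_pow _) fun b hb => ?_
  obtain ⟨t, rfl⟩ : ∃ t, s = t + 1 := ⟨s - 1, by omega⟩
  rw [shiftedHarmonic_eq_sub hs hb, Nat.add_sub_cancel]
  field_simp
  ring

theorem shiftedHarmonic_sq {s : ℕ} (hs : 1 ≤ s) : SlowlyVarying fun b => H s b ^ 2 := by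
  have hH := LogBounded.shiftedHarmonic hs
  refine .of_logBounded (q := fun x => (2 * H s x - 1 / x ^ s) * (1 / x ^ (s - 1)))
    (shiftedHarmonic_pow_monotoneOn 2 hs)
    (((((LogBounded.const 2).mul hH)).sub (.one_div_pow s)).mul (.one_div_pow _)) fun b hb => ?_
  obtain ⟨t, rfl⟩ : ∃ t, s = t + 1 := ⟨s - 1, by omega⟩
  rw [shiftedHarmonic_eq_sub hs hb, Nat.add_sub_cancel]
  field_simp
  ring

theorem shiftedHarmonic_one_mul {s : ℕ} (hs : 1 ≤ s) : SlowlyVarying fun b => H 1 b * H s b := by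
  have hH1 := LogBounded.shiftedHarmonic le_rfl
  have hH := LogBounded.shiftedHarmonic hs
  refine .of_logBounded (q := fun x => H 1 x * (1 / x ^ (s - 1)) + H s x - 1 / x ^ s)
    (monotoneOn_mul (shiftedHarmonic_monotoneOn_Ici le_rfl) (shiftedHarmonic_monotoneOn_Ici hs)
      (fun x hx => shiftedHarmonic_nonneg le_rfl hx) (fun x hx => shiftedHarmonic_nonneg hs hx))
    (((hH1.mul (.one_div_pow _)).add hH).sub (.one_div_pow s)) fun b hb => ?_
  obtain ⟨t, rfl⟩ : ∃ t, s = t + 1 := ⟨s - 1, by omega⟩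
  rw [shiftedHarmonic_eq_sub hs hb, shiftedHarmonic_eq_sub le_rfl hb, Nat.add_sub_cancel]
  field_simp
  ring

theorem shiftedHarmonic_one_cube : SlowlyVarying fun b => H 1 b ^ 3 := by
  have hH := LogBounded.shiftedHarmonic (s := 1) le_rfl
  refine .of_logBounded (q := fun x => 3 * H 1 x ^ 2 - 3 * (H 1 x / x) + 1 / x ^ 2)
    (shiftedHarmonic_pow_monotoneOn 3 le_rfl)
    ((((LogBounded.const 3).mul (hH.pow 2)).sub ((LogBounded.const 3).mul hH.div)).add
      (.one_div_pow 2)) fun b hb => ?_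
  rw [shiftedHarmonic_eq_sub le_rfl hb]
  field_simp
  ring

theorem shiftedHarmonic_one_sq_mul_two : SlowlyVarying fun b => H 1 b ^ 2 * H 2 b := by
  have hH := LogBounded.shiftedHarmonic (s := 1) le_rfl
  have hH2 := LogBounded.shiftedHarmonic (s := 2) one_le_two
  refine .of_logBounded (q := fun x => H 1 x ^ 2 / x + 2 * (H 1 x * H 2 x) - 2 * (H 1 x / x ^ 2)
      - H 2 x / x + 1 / x ^ 3)
    (monotoneOn_mul (shiftedHarmonic_pow_monotoneOn 2 le_rfl)
      (shiftedHarmonic_monotoneOn_Ici one_le_two) (fun x _ => sq_nonneg _)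
      (fun x hx => shiftedHarmonic_nonneg one_le_two hx))
    ((((((hH.pow 2).div).add ((LogBounded.const 2).mul (hH.mul hH2))).sub
      ((LogBounded.const 2).mul (hH.div_pow 2))).sub hH2.div).add (.one_div_pow 3)) fun b hb => ?_
  rw [shiftedHarmonic_eq_sub le_rfl hb, shiftedHarmonic_eq_sub one_le_two hb]
  field_simp
  ring

end SlowlyVarying

/-! ### Evaluation of weighted sums -/

/-- Evaluation of a weighted sum, plus a tail series, from its increments. -/
theorem weightedSum_add_tail {g q G W : ℝ → ℝ} {c : ℝ} (hc : c ≠ 0) (hg : LogBounded g)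
    (hm : MonotoneOn g (Ici 0)) (h0 : ∀ x : ℝ, 0 ≤ x → 0 ≤ g x) (hq : LogBounded q)
    (hG : SlowlyVarying G)
    (hW : ∀ b : ℝ, 0 ≤ b →
      HasSum (fun n : ℕ => (g (n + 1 + (b + 1)) - g (n + 1 + b)) / ((n : ℝ) + 1)) (W (b + 1)))
    (hinc : ∀ b : ℝ, 0 ≤ b →
      G (b + 1) - G b = c * (W (b + 1) + g (b + 1) / (b + 1)) - q (b + 1) / (b + 1) ^ 2)
    {b : ℝ} (hb : 0 ≤ b) :
    c * weightedSum g b + ∑' n : ℕ, q (n + 1 + b) / ((n : ℝ) + 1 + b) ^ 2 =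
      G b - G 0 + ∑' n : ℕ, q (n + 1) / ((n : ℝ) + 1) ^ 2 := by
  have hF : ∀ b : ℝ, 0 ≤ b →
      c * (weightedSum g (b + 1) - weightedSum g b) = G (b + 1) - G b + q (b + 1) / (b + 1) ^ 2 := by
    intro b hb
    rw [hinc b hb, hg.weightedSum_add_one hb (hW b hb)]
    ring
  -- Being monotone, the weighted sum needs only its unit increments along the integers to vanish;
  -- these come from `hF` and the slow variation of G.
  have h1 : SlowlyVarying (weightedSum g) := by
    refine .of_monotoneOn (weightedSum_monotoneOn hg hm h0) ?_
    have h2 := hG 1 zero_le_one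
    have h3 := hq.div.tendsto_div le_rfl
    have h4 := (h2.add h3).const_mul c⁻¹
    rw [add_zero, mul_zero] at h4
    refine h4.congr fun n => ?_
    have h5 := hF n n.cast_nonneg
    rw [add_zero, div_div, ← sq, ← h5, inv_mul_cancel_left₀ hc]
  have h2 := (((h1.const_mul c).add (.tsum_tail fun x => q x / x ^ 2)).sub hG).eq_apply_zero
    (fun b hb => ?_) hb
  · simp only [weightedSum_zero, add_zero, mul_zero, zero_add] at h2
    linarith
  · rw [tsum_shift_sub (φ := fun x => q x / x ^ 2) (hq.summable_div_sq hb)]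
    linarith [hF b hb]

/-- The value of `∑ 1 / (j (j + b) ^ m)` over `j ≥ 1`. -/
noncomputable def reciprocalSum : ℕ → ℝ → ℝ
  | 0, _ => 0
  | 1, b => H 1 b / b
  | m + 2, b => (reciprocalSum (m + 1) b - (zetaValue (m + 2) - H (m + 2) b)) / b

/-- Induction on m through 1/(j x^(m+1)) = (1/(j x^m) - 1/x^(m+1))/b with x = j + b. -/
theorem hasSum_reciprocalSum {m : ℕ} (hm : 1 ≤ m) {b : ℝ} (hb : 0 < b) :
    HasSum (fun n : ℕ => 1 / ((n : ℝ) + 1 + b) ^ m / ((n : ℝ) + 1)) (reciprocalSum m b) := by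
  induction m, hm using Nat.le_induction with
  | base =>
    refine ((hasSum_shiftedHarmonic_one (show -1 < b by linarith)).div_const b).congr_fun
      fun n => ?_
    have : (0 : ℝ) < n + 1 + b := by positivity
    field_simp
    ring
  | succ m hm ih =>
    obtain ⟨t, rfl⟩ : ∃ t, m = t + 1 := ⟨m - 1, by omega⟩
    refine ((ih.sub (hasSum_hurwitz (show 2 ≤ t + 2 by omega)
      (show -1 < b by linarith))).div_const b).congr_fun fun n => ?_
    have : (0 : ℝ) < n + 1 + b := by positivity
    field_simp
    ring

/-- With x = b + 1 both sides have the increment 2 H_x / x. -/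
theorem weightedSum_shiftedHarmonic_one {b : ℝ} (hb : 0 ≤ b) :
    weightedSum (H 1) b = H 1 b ^ 2 + H 2 b := by
  have := weightedSum_add_tail (g := H 1) (q := fun _ => 0) (c := 1)
    (G := fun b => H 1 b ^ 2 + H 2 b) (W := reciprocalSum 1) one_ne_zero (.shiftedHarmonic le_rfl)
    (shiftedHarmonic_monotoneOn_Ici le_rfl) (fun x hx => shiftedHarmonic_nonneg le_rfl hx)
    (.const 0) ((SlowlyVarying.shiftedHarmonic_sq le_rfl).add (.shiftedHarmonic one_le_two))
    (fun b hb => ?_) (fun b hb => ?_) hb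
  · simpa [shiftedHarmonic_zero] using this
  · refine (hasSum_reciprocalSum le_rfl (show 0 < b + 1 by linarith)).congr_fun fun n => ?_
    rw [← add_assoc, shiftedHarmonic_add_one le_rfl (by linarith [n.cast_nonneg (α := ℝ)])]
    ring
  · rw [shiftedHarmonic_eq_sub le_rfl hb, shiftedHarmonic_eq_sub one_le_two hb, reciprocalSum]
    field_simp
    ring

/-- The summand H^{(2)} makes the increment of g exactly 2 H_x / x, so W is twice the previous
evaluation divided by its argument. -/
theorem weightedSum_second_bell {b : ℝ} (hb : 0 ≤ b) :
    weightedSum (fun x => H 1 x ^ 2 + H 2 x) b =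
      H 1 b ^ 3 + 3 * (H 1 b * H 2 b) + 2 * H 3 b := by
  have hH := LogBounded.shiftedHarmonic (s := 1) le_rfl
  have hH2 := LogBounded.shiftedHarmonic (s := 2) one_le_two
  have := weightedSum_add_tail (g := fun x => H 1 x ^ 2 + H 2 x) (q := fun _ => 0) (c := 1)
    (G := fun b => H 1 b ^ 3 + 3 * (H 1 b * H 2 b) + 2 * H 3 b)
    (W := fun b => 2 * ((H 1 b ^ 2 + H 2 b) / b)) one_ne_zero ((hH.pow 2).add hH2)
    ((shiftedHarmonic_pow_monotoneOn 2 le_rfl).add (shiftedHarmonic_monotoneOn_Ici one_le_two))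
    (fun x hx => add_nonneg (sq_nonneg _) (shiftedHarmonic_nonneg one_le_two hx))
    (.const 0) ((SlowlyVarying.shiftedHarmonic_one_cube.add
      ((SlowlyVarying.shiftedHarmonic_one_mul one_le_two).const_mul 3)).add
      ((SlowlyVarying.shiftedHarmonic (show 1 ≤ 3 by norm_num)).const_mul 2))
    (fun b hb => ?_) (fun b hb => ?_) hb
  · simpa [shiftedHarmonic_zero] using this
  · have h1 := (hH.hasSum_div_mul (show 0 < b + 1 by linarith)).mul_left 2
    rw [weightedSum_shiftedHarmonic_one (by linarith)] at h1
    refine h1.congr_fun fun n => ?_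
    have h2 : (0 : ℝ) ≤ n + 1 + b := by positivity
    rw [← add_assoc, shiftedHarmonic_eq_sub le_rfl h2, shiftedHarmonic_eq_sub one_le_two h2]
    field_simp
    ring
  · rw [shiftedHarmonic_eq_sub le_rfl hb, shiftedHarmonic_eq_sub one_le_two hb,
      shiftedHarmonic_eq_sub (show 1 ≤ 3 by norm_num) hb]
    field_simp
    ring

/-! ### Euler sums as limits at b = 0 -/

theorem tendsto_div_zero_right {f : ℝ → ℝ} {f' : ℝ} (hf : HasDerivAt f f' 0) (h0 : f 0 = 0) :
    Tendsto (fun b : ℝ => f b / b) (𝓝[>] 0) (𝓝 f') := by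
  refine hf.tendsto_slope_zero_right.congr fun t => ?_
  rw [zero_add, h0, sub_zero, smul_eq_mul, inv_mul_eq_div]

theorem hasDerivAt_shiftedHarmonic_zero {s : ℕ} (hs : 1 ≤ s) :
    HasDerivAt (H s) (s * zetaValue (s + 1)) 0 := by
  have := hasDerivAt_shiftedHarmonic hs (show (-1 : ℝ) < 0 by norm_num)
  rwa [shiftedHarmonic_zero (by omega), sub_zero] at this

theorem continuousAt_shiftedHarmonic {s : ℕ} (hs : 1 ≤ s) {b : ℝ} (hb : -1 < b) :
    ContinuousAt (H s) b := (hasDerivAt_shiftedHarmonic hs hb).continuousAt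

/-- The limit at `0` of an evaluated weighted sum is a series at the integers. -/
theorem LogBounded.tsum_eq_of_tendsto {g G : ℝ → ℝ} {L : ℝ} (hg : LogBounded g)
    (hc : ∀ n : ℕ, ContinuousAt g (n + 1))
    (hG : ∀ b : ℝ, 0 < b → weightedSum g b / b = G b) (hL : Tendsto G (𝓝[>] 0) (𝓝 L)) :
    ∑' n : ℕ, g (n + 1) / ((n : ℝ) + 1) ^ 2 = L := by
  refine tendsto_nhds_unique (hg.tendsto_tsum hc) (hL.congr' ?_)
  filter_upwards [self_mem_nhdsWithin] with b hb
  rw [← hG b hb, (hg.hasSum_div_mul hb).tsum_eq]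

/-- Euler's evaluation of `∑ H_n / n ^ 2`. -/
theorem tsum_shiftedHarmonic_one_div_sq :
    ∑' n : ℕ, H 1 (n + 1) / ((n : ℝ) + 1) ^ 2 = 2 * zetaValue 3 := by
  refine (LogBounded.shiftedHarmonic le_rfl).tsum_eq_of_tendsto
    (fun n => continuousAt_shiftedHarmonic le_rfl (by linarith [n.cast_nonneg (α := ℝ)]))
    (G := fun b => (H 1 b ^ 2 + H 2 b) / b)
    (fun b hb => by rw [weightedSum_shiftedHarmonic_one hb.le]) ?_
  refine tendsto_div_zero_right ?_ (by simp [shiftedHarmonic_zero])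
  refine (((hasDerivAt_shiftedHarmonic_zero (s := 1) le_rfl).fun_pow 2).add
    (hasDerivAt_shiftedHarmonic_zero one_le_two)).congr_deriv ?_
  simp [shiftedHarmonic_zero]

theorem tsum_second_bell_div_sq :
    ∑' n : ℕ, (H 1 (n + 1) ^ 2 + H 2 (n + 1)) / ((n : ℝ) + 1) ^ 2 = 6 * zetaValue 4 := by
  have hH := LogBounded.shiftedHarmonic (s := 1) le_rfl
  have hH2 := LogBounded.shiftedHarmonic (s := 2) one_le_two
  refine ((hH.pow 2).add hH2).tsum_eq_of_tendsto
    (fun n => ((continuousAt_shiftedHarmonic le_rfl (by linarith [n.cast_nonneg (α := ℝ)])).pow 2).add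
      (continuousAt_shiftedHarmonic one_le_two (by linarith [n.cast_nonneg (α := ℝ)])))
    (G := fun b => (H 1 b ^ 3 + 3 * (H 1 b * H 2 b) + 2 * H 3 b) / b)
    (fun b hb => by rw [weightedSum_second_bell hb.le]) ?_
  refine tendsto_div_zero_right ?_ (by simp [shiftedHarmonic_zero])
  have h1 := hasDerivAt_shiftedHarmonic_zero (s := 1) le_rfl
  refine (((h1.fun_pow 3).add ((h1.fun_mul
    (hasDerivAt_shiftedHarmonic_zero one_le_two)).const_mul 3)).add
    ((hasDerivAt_shiftedHarmonic_zero (s := 3) (by norm_num)).const_mul 2)).congr_deriv ?_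
  simp [shiftedHarmonic_zero]
  ring

/-! ### The mixed sum -/

/-- The value of `∑ (H_x / x ^ 2 + H_x^{(2)} / x) / j` over `j ≥ 1`, where `x = j + b`. -/
noncomputable def mixedSum (b : ℝ) : ℝ :=
  (2 * (H 1 b * H 2 b) + 2 * H 3 b - zetaValue 2 * H 1 b - 2 * zetaValue 3 +
    (H 1 b ^ 2 + H 2 b) / b) / b

/-- With x = b + 1, `weightedSum (H 2)` has the increment H_x/x² + 2 H_x^{(2)}/x - ζ(2)/x. The tail
contributes a second H_x/x², and the total is the increment of 2 H H^{(2)} + 2 H^{(3)} - ζ(2) H. The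
constant -2ζ(3) is Euler's sum. -/
theorem weightedSum_two_sub_tsum {b : ℝ} (hb : 0 ≤ b) :
    weightedSum (H 2) b - ∑' n : ℕ, H 1 (n + 1 + b) / ((n : ℝ) + 1 + b) ^ 2 =
      2 * (H 1 b * H 2 b) + 2 * H 3 b - zetaValue 2 * H 1 b - 2 * zetaValue 3 := by
  have hH := LogBounded.shiftedHarmonic (s := 1) le_rfl
  have := weightedSum_add_tail (g := H 2) (q := fun x => -1 * H 1 x) (c := 1)
    (G := fun b => 2 * (H 1 b * H 2 b) + 2 * H 3 b - zetaValue 2 * H 1 b)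
    (W := reciprocalSum 2) one_ne_zero (.shiftedHarmonic one_le_two)
    (shiftedHarmonic_monotoneOn_Ici one_le_two)
    (fun x hx => shiftedHarmonic_nonneg one_le_two hx) ((LogBounded.const (-1)).mul hH)
    ((((SlowlyVarying.shiftedHarmonic_one_mul one_le_two).const_mul 2).add
      ((SlowlyVarying.shiftedHarmonic (show 1 ≤ 3 by norm_num)).const_mul 2)).sub
      ((SlowlyVarying.shiftedHarmonic le_rfl).const_mul _))
    (fun b hb => ?_) (fun b hb => ?_) hb
  · simp only [neg_one_mul, neg_div, tsum_neg, tsum_shiftedHarmonic_one_div_sq] at this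
    simp only [shiftedHarmonic_zero le_rfl, shiftedHarmonic_zero one_le_two,
      shiftedHarmonic_zero (show 1 ≤ 3 by norm_num)] at this
    linarith
  · refine (hasSum_reciprocalSum one_le_two (show 0 < b + 1 by linarith)).congr_fun fun n => ?_
    rw [← add_assoc, shiftedHarmonic_add_one one_le_two (by linarith [n.cast_nonneg (α := ℝ)])]
    ring
  · rw [shiftedHarmonic_eq_sub le_rfl hb, shiftedHarmonic_eq_sub one_le_two hb,
      shiftedHarmonic_eq_sub (show 1 ≤ 3 by norm_num) hb, reciprocalSum, reciprocalSum]
    field_simp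
    ring

/-- Splitting 1/(jx) as (1/j - 1/x)/b produces the tail -∑ H_x/x² next to `weightedSum (H 2)`, which
is exactly the combination just evaluated. -/
theorem hasSum_mixedSum {b : ℝ} (hb : 0 < b) :
    HasSum (fun n : ℕ => (H 1 (n + 1 + b) / ((n : ℝ) + 1 + b) + H 2 (n + 1 + b)) /
      (((n : ℝ) + 1) * ((n : ℝ) + 1 + b))) (mixedSum b) := by
  have hH := LogBounded.shiftedHarmonic (s := 1) le_rfl
  have hH2 := LogBounded.shiftedHarmonic (s := 2) one_le_two
  have h1 := (hH2.summable_weightedSum hb.le).hasSum.sub (hH.summable_div_sq hb.le).hasSum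
  rw [← weightedSum, weightedSum_two_sub_tsum hb.le] at h1
  have h2 := hH.hasSum_div_mul hb
  rw [weightedSum_shiftedHarmonic_one hb.le] at h2
  refine ((h1.add h2).div_const b).congr_fun fun n => ?_
  have : (0 : ℝ) < n + 1 + b := by positivity
  field_simp
  ring

/-- `mixedSum` divides H^{(2)} by b twice, so its limit needs the second-order term at 0. By
l'Hôpital's rule it comes from -2 H_b^{(3)}/(2b). -/
theorem tendsto_shiftedHarmonic_two_sub_div_sq :
    Tendsto (fun b : ℝ => (H 2 b - 2 * zetaValue 3 * b) / b ^ 2) (𝓝[>] 0)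
      (𝓝 (-3 * zetaValue 4)) := by
  have h3 := hasDerivAt_shiftedHarmonic_zero (s := 3) (by norm_num)
  have h0 : Tendsto (fun b : ℝ => H 2 b - 2 * zetaValue 3 * b) (𝓝[>] 0) (𝓝 0) := by
    have h : ContinuousAt (fun b : ℝ => H 2 b - 2 * zetaValue 3 * b) 0 :=
      (continuousAt_shiftedHarmonic one_le_two (by norm_num)).sub (by fun_prop)
    simpa [shiftedHarmonic_zero] using h.tendsto.mono_left (nhdsWithin_le_nhds (s := Ioi 0))
  have h0' : Tendsto (fun b : ℝ => b ^ 2) (𝓝[>] 0) (𝓝 0) := by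
    have h : ContinuousAt (fun b : ℝ => b ^ 2) 0 := by fun_prop
    simpa using h.tendsto.mono_left (nhdsWithin_le_nhds (s := Ioi 0))
  refine HasDerivAt.lhopital_zero_nhdsGT (f' := fun b => -2 * H 3 b) (g' := fun b => 2 * b)
    ?_ ?_ ?_ h0 h0' ?_
  · filter_upwards [self_mem_nhdsWithin] with b hb
    rw [mem_Ioi] at hb
    refine ((hasDerivAt_shiftedHarmonic one_le_two (by linarith)).sub
      ((hasDerivAt_id b).const_mul (2 * zetaValue 3))).congr_deriv ?_
    push_cast
    ring
  · refine Eventually.of_forall fun b => ?_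
    simpa using hasDerivAt_pow 2 b
  · filter_upwards [self_mem_nhdsWithin] with b hb
    rw [mem_Ioi] at hb
    positivity
  · have h4 := (tendsto_div_zero_right h3 (shiftedHarmonic_zero (by norm_num))).const_mul (-1)
    refine (h4.congr fun b => ?_).trans_eq ?_
    · rcases eq_or_ne b 0 with rfl | hb
      · simp
      · field_simp
    · norm_num

theorem tendsto_mixedSum : Tendsto mixedSum (𝓝[>] 0) (𝓝 (3 * zetaValue 4)) := by
  have h1 := tendsto_div_zero_right (hasDerivAt_shiftedHarmonic_zero (s := 1) le_rfl)
    (shiftedHarmonic_zero le_rfl)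
  have h3 := tendsto_div_zero_right (hasDerivAt_shiftedHarmonic_zero (s := 3) (by norm_num))
    (shiftedHarmonic_zero (by norm_num))
  have h2 : Tendsto (H 2) (𝓝[>] 0) (𝓝 0) := by
    have h := (continuousAt_shiftedHarmonic (s := 2) one_le_two
      (show (-1 : ℝ) < 0 by norm_num)).tendsto
    rw [shiftedHarmonic_zero one_le_two] at h
    exact h.mono_left nhdsWithin_le_nhds
  have h := ((((h1.mul h2).const_mul 2).add (h3.const_mul 2)).sub
    (h1.const_mul (zetaValue 2))).add ((h1.pow 2).add tendsto_shiftedHarmonic_two_sub_div_sq)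
  refine (h.congr' ?_).trans_eq ?_
  · filter_upwards [self_mem_nhdsWithin] with b hb
    rw [mem_Ioi] at hb
    rw [mixedSum]
    field_simp
    ring
  · congr 1
    norm_num
    ring

theorem tsum_mixed_div_sq :
    ∑' n : ℕ, (H 1 (n + 1) / ((n : ℝ) + 1) + H 2 (n + 1)) / ((n : ℝ) + 1) ^ 2 =
      3 * zetaValue 4 := by
  have hg := (LogBounded.shiftedHarmonic (s := 1) le_rfl).div.add
    (LogBounded.shiftedHarmonic (s := 2) one_le_two)
  refine hg.tsum_eq_of_tendsto (fun n => ?_) (G := mixedSum) (fun b hb => ?_) tendsto_mixedSum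
  · have hn : (0 : ℝ) ≤ n := n.cast_nonneg
    exact ((continuousAt_shiftedHarmonic le_rfl (by linarith)).div continuousAt_id
      (by positivity : (n : ℝ) + 1 ≠ 0)).add
      (continuousAt_shiftedHarmonic one_le_two (by linarith))
  · exact (hg.hasSum_div_mul hb).unique (hasSum_mixedSum hb)

/-- Twice the mixed Euler sum and the second Bell sum both equal 6ζ(4). This is why `quarticPart`
carries no additive constant. -/
theorem tsum_quadratic_div_sq :
    ∑' n : ℕ, (2 * (H 1 (n + 1) / ((n : ℝ) + 1)) + H 2 (n + 1) - H 1 (n + 1) ^ 2) /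
      ((n : ℝ) + 1) ^ 2 = 0 := by
  have hH := LogBounded.shiftedHarmonic (s := 1) le_rfl
  have hH2 := LogBounded.shiftedHarmonic (s := 2) one_le_two
  have h1 := ((hH.div.add hH2).summable_div_sq le_rfl).mul_left 2
  have h2 := ((hH.pow 2).add hH2).summable_div_sq le_rfl
  simp only [add_zero] at h1 h2
  have h3 := (h1.tsum_sub h2)
  rw [tsum_mul_left, tsum_mixed_div_sq, tsum_second_bell_div_sq] at h3
  rw [← sub_eq_zero.2 (show (2 : ℝ) * (3 * zetaValue 4) = 6 * zetaValue 4 by ring), ← h3]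
  refine tsum_congr fun n => ?_
  ring

/-! ### The quartic part -/

/-- The closed form of a regularization of `2 ∑ H_x H_x^{(2)} (1 / j - 1 / x)`. -/
noncomputable def quarticPart (b : ℝ) : ℝ :=
  3 * (H 1 b ^ 2 * H 2 b) + 2 * (H 1 b * H 3 b) + H 2 b ^ 2 -
    zetaValue 2 * (H 1 b ^ 2 - H 2 b) - 2 * zetaValue 3 * H 1 b

theorem two_mul_weightedSum_add_tsum {b : ℝ} (hb : 0 ≤ b) :
    2 * weightedSum (fun x => H 1 x * H 2 x) b +
      ∑' n : ℕ, (2 * (H 1 (n + 1 + b) / ((n : ℝ) + 1 + b)) + H 2 (n + 1 + b) -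
        H 1 (n + 1 + b) ^ 2) / ((n : ℝ) + 1 + b) ^ 2 = quarticPart b := by
  have hH := LogBounded.shiftedHarmonic (s := 1) le_rfl
  have hH2 := LogBounded.shiftedHarmonic (s := 2) one_le_two
  have := weightedSum_add_tail (g := fun x => H 1 x * H 2 x)
    (q := fun x => 2 * (H 1 x / x) + H 2 x - H 1 x ^ 2) (c := 2)
    (G := quarticPart)
    (W := fun b => mixedSum b - reciprocalSum 3 b) two_ne_zero (hH.mul hH2)
    (monotoneOn_mul (shiftedHarmonic_monotoneOn_Ici le_rfl)
      (shiftedHarmonic_monotoneOn_Ici one_le_two) (fun x hx => shiftedHarmonic_nonneg le_rfl hx)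
      (fun x hx => shiftedHarmonic_nonneg one_le_two hx))
    (fun x hx => mul_nonneg (shiftedHarmonic_nonneg le_rfl hx)
      (shiftedHarmonic_nonneg one_le_two hx))
    ((((LogBounded.const 2).mul hH.div).add hH2).sub (hH.pow 2))
    (((((SlowlyVarying.shiftedHarmonic_one_sq_mul_two.const_mul 3).add
      ((SlowlyVarying.shiftedHarmonic_one_mul (show 1 ≤ 3 by norm_num)).const_mul 2)).add
      (SlowlyVarying.shiftedHarmonic_sq one_le_two)).sub
      (((SlowlyVarying.shiftedHarmonic_sq le_rfl).sub
        (SlowlyVarying.shiftedHarmonic one_le_two)).const_mul _)).sub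
      ((SlowlyVarying.shiftedHarmonic le_rfl).const_mul _))
    (fun b hb => ?_) (fun b hb => ?_) hb
  · rw [tsum_quadratic_div_sq] at this
    rw [this]
    simp [quarticPart, shiftedHarmonic_zero]
  · have hb1 : 0 < b + 1 := by linarith
    refine ((hasSum_mixedSum hb1).sub
      (hasSum_reciprocalSum (show 1 ≤ 3 by norm_num) hb1)).congr_fun fun n => ?_
    have h2 : (0 : ℝ) ≤ n + 1 + b := by positivity
    rw [← add_assoc, shiftedHarmonic_eq_sub le_rfl h2, shiftedHarmonic_eq_sub one_le_two h2]
    field_simp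
    ring
  · simp only [quarticPart, mixedSum, reciprocalSum]
    rw [shiftedHarmonic_eq_sub le_rfl hb, shiftedHarmonic_eq_sub one_le_two hb,
      shiftedHarmonic_eq_sub (show 1 ≤ 3 by norm_num) hb]
    field_simp
    ring

/-! ### The increment series for the four choices of g -/

theorem hasSum_increment_shiftedHarmonic {m : ℕ} (hm : 1 ≤ m) {b : ℝ} (hb : 0 < b) :
    HasSum (fun n : ℕ => (H m (n + 1 + b) - H m (n + b)) / ((n : ℝ) + 1)) (reciprocalSum m b) := by
  refine (hasSum_reciprocalSum hm hb).congr_fun fun n => ?_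
  rw [add_right_comm, shiftedHarmonic_add_one hm (by linarith [n.cast_nonneg (α := ℝ)])]
  ring

theorem hasSum_increment_one_mul_two {b : ℝ} (hb : 0 < b) :
    HasSum (fun n : ℕ => (H 1 (n + 1 + b) * H 2 (n + 1 + b) - H 1 (n + b) * H 2 (n + b)) /
      ((n : ℝ) + 1)) (mixedSum b - reciprocalSum 3 b) := by
  refine ((hasSum_mixedSum hb).sub
    (hasSum_reciprocalSum (show 1 ≤ 3 by norm_num) hb)).congr_fun fun n => ?_
  have h2 : (0 : ℝ) ≤ n + b := by positivity
  rw [add_right_comm, shiftedHarmonic_eq_sub le_rfl h2, shiftedHarmonic_eq_sub one_le_two h2]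
  field_simp
  ring

theorem hasSum_second_bell {b : ℝ} (hb : 0 < b) :
    HasSum (fun n : ℕ => (H 1 (n + 1 + b) ^ 2 + H 2 (n + 1 + b)) /
      (((n : ℝ) + 1) * ((n : ℝ) + 1 + b)))
      ((H 1 b ^ 3 + 3 * (H 1 b * H 2 b) + 2 * H 3 b) / b) := by
  rw [← weightedSum_second_bell hb.le]
  exact (((LogBounded.shiftedHarmonic (s := 1) le_rfl).pow 2).add
    (LogBounded.shiftedHarmonic (s := 2) one_le_two)).hasSum_div_mul hb

/-- With x = n + 1 + b the increment is 3H²/x - 3H/x² + 1/x³. Adding and subtracting 3H^{(2)}/x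
turns it into a Bell part and a mixed part, both already summed. -/
theorem hasSum_increment_one_cube {b : ℝ} (hb : 0 < b) :
    HasSum (fun n : ℕ => (H 1 (n + 1 + b) ^ 3 - H 1 (n + b) ^ 3) / ((n : ℝ) + 1))
      (3 * ((H 1 b ^ 3 + 3 * (H 1 b * H 2 b) + 2 * H 3 b) / b) - 3 * mixedSum b +
        reciprocalSum 3 b) := by
  refine ((((hasSum_second_bell hb).mul_left 3).sub ((hasSum_mixedSum hb).mul_left 3)).add
    (hasSum_reciprocalSum (show 1 ≤ 3 by norm_num) hb)).congr_fun fun n => ?_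
  have h2 : (0 : ℝ) ≤ n + b := by positivity
  rw [add_right_comm, shiftedHarmonic_eq_sub le_rfl h2]
  field_simp
  ring

/-- The increment is 2HH^{(2)}/x + (H² - 2H/x - H^{(2)})/x² + 1/x⁴. After division by j, the
splitting 1/(jx) = (1/j - 1/x)/b gives the weighted sum of 2HH^{(2)}, the tail with numerator 2H/x +
H^{(2)} - H² that completes it to `quarticPart`, and the Bell sum minus twice the mixed sum. -/
theorem hasSum_increment_one_sq_mul_two {b : ℝ} (hb : 0 < b) :
    HasSum (fun n : ℕ => (H 1 (n + 1 + b) ^ 2 * H 2 (n + 1 + b) - H 1 (n + b) ^ 2 * H 2 (n + b)) /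
      ((n : ℝ) + 1))
      ((quarticPart b + (H 1 b ^ 3 + 3 * (H 1 b * H 2 b) + 2 * H 3 b) / b - 2 * mixedSum b) / b +
        reciprocalSum 4 b) := by
  have hH := LogBounded.shiftedHarmonic (s := 1) le_rfl
  have hH2 := LogBounded.shiftedHarmonic (s := 2) one_le_two
  have h1 : HasSum _ (2 * weightedSum (fun x => H 1 x * H 2 x) b) :=
    ((hH.mul hH2).summable_weightedSum hb.le).hasSum.mul_left 2
  have h2 := ((((LogBounded.const 2).mul hH.div).add hH2).sub
    (hH.pow 2)).summable_div_sq hb.le |>.hasSum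
  have h3 := h1.add h2
  rw [two_mul_weightedSum_add_tsum hb.le] at h3
  refine ((((h3.add (hasSum_second_bell hb)).sub ((hasSum_mixedSum hb).mul_left 2)).div_const
    b).add (hasSum_reciprocalSum (show 1 ≤ 4 by norm_num) hb)).congr_fun fun n => ?_
  have h2 : (0 : ℝ) ≤ n + b := by positivity
  rw [add_right_comm, shiftedHarmonic_eq_sub le_rfl h2, shiftedHarmonic_eq_sub one_le_two h2]
  field_simp
  ring

/-! ### Summation by parts -/

/-- Summation by parts for `∑ g (n + α) (1 / (n + i) - 1 / (n + i + 1))`. -/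
theorem LogBounded.hasSum_mul_sub_succ {g : ℝ → ℝ} (hg : LogBounded g) {i : ℕ} {α W : ℝ}
    (hα : 0 ≤ α) (hW : HasSum (fun n : ℕ =>
      (g (n + 1 + (α - i)) - g (n + (α - i))) / ((n : ℝ) + 1)) W) :
    HasSum (fun n : ℕ => g (n + 1 + α) * (1 / ((n : ℝ) + 1 + i) - 1 / ((n : ℝ) + 1 + i + 1)))
      (W - ∑ j ∈ Finset.range i,
        (g (j + 1 + (α - i)) - g (j + (α - i))) / ((j : ℝ) + 1) + g α / ((i : ℝ) + 1)) := by
  -- Dropping the first i terms turns the denominators n + 1 into n + 1 + i and the argument α - i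
  -- into α.
  have h1 := (hasSum_nat_add_iff' i).2 hW
  obtain ⟨φ, hφ⟩ : ∃ φ : ℕ → ℝ, φ = fun n : ℕ => g (n + α) / ((n : ℝ) + 1 + i) := ⟨_, rfl⟩
  have h2 : Summable fun n : ℕ =>
      g (n + 1 + α) * (1 / ((n : ℝ) + 1 + i) - 1 / ((n : ℝ) + 1 + i + 1)) := by
    refine hg.summable hα 1 fun n => ?_
    have h : 1 / ((n : ℝ) + 1 + i) - 1 / ((n : ℝ) + 1 + i + 1) =
        1 / (((n : ℝ) + 1 + i) * (n + 1 + i + 1)) := by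
      field_simp
      ring
    rw [h, abs_mul, abs_of_nonneg (by positivity :
      (0 : ℝ) ≤ 1 / (((n : ℝ) + 1 + i) * (n + 1 + i + 1))), mul_one_div, one_mul]
    refine div_le_div_of_nonneg_left (abs_nonneg _) (by positivity) ?_
    nlinarith [n.cast_nonneg (α := ℝ), i.cast_nonneg (α := ℝ)]
  have h3 : ∀ n : ℕ, φ n - φ (n + 1) =
      g (n + 1 + α) * (1 / ((n : ℝ) + 1 + i) - 1 / ((n : ℝ) + 1 + i + 1)) -
        (g (((n + i : ℕ) : ℝ) + 1 + (α - i)) - g (((n + i : ℕ) : ℝ) + (α - i))) /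
          (((n + i : ℕ) : ℝ) + 1) := by
    intro n
    simp only [hφ]
    push_cast
    rw [show (n : ℝ) + i + 1 + (α - i) = n + 1 + α by ring,
      show (n : ℝ) + i + (α - i) = n + α by ring]
    have h4 : (0 : ℝ) < n + 1 + i := by positivity
    have h5 : (0 : ℝ) < n + i + 1 := by positivity
    have h6 : (0 : ℝ) < n + 1 + 1 + i := by positivity
    have h7 : (0 : ℝ) < n + 1 + i + 1 := by positivity
    rw [show (n : ℝ) + 1 + 1 + i = n + 1 + i + 1 by ring,
      show (n : ℝ) + i + 1 = n + 1 + i by ring]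
    ring
  have h4 : Tendsto φ atTop (𝓝 0) := by
    rw [← tendsto_add_atTop_iff_nat 1]
    have h0 := (hg.tendsto_div hα).norm
    rw [norm_zero] at h0
    refine squeeze_zero_norm (fun n => ?_) h0
    simp only [hφ]
    push_cast
    rw [norm_div, norm_div, Real.norm_of_nonneg (by positivity : (0 : ℝ) ≤ n + 1 + 1 + i),
      Real.norm_of_nonneg (by positivity : (0 : ℝ) ≤ n + 1)]
    exact div_le_div_of_nonneg_left (norm_nonneg _) (by positivity)
      (by linarith [i.cast_nonneg (α := ℝ)])
  have h5 := hasSum_sub_succ ((h2.sub h1.summable).congr fun n => (h3 n).symm) h4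
  have h6 : φ 0 = g α / ((i : ℝ) + 1) := by
    simp only [hφ]
    rw [Nat.cast_zero, zero_add, zero_add, add_comm (1 : ℝ)]
  rw [← h6]
  refine (h1.add h5).congr_fun fun n => ?_
  rw [h3]
  ring

/-! ### Membership in the algebra of closed forms -/

namespace closedForms

variable {N : ℕ} {f g : ℝ → ℝ}

theorem const_mem (N : ℕ) (q : ℚ) : (fun _ : ℝ => (q : ℝ)) ∈ closedForms N :=
  (closedForms N).algebraMap_mem q

theorem add_fun_mem (hf : f ∈ closedForms N) (hg : g ∈ closedForms N) :
    (fun α => f α + g α) ∈ closedForms N := add_mem hf hg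

theorem sub_fun_mem (hf : f ∈ closedForms N) (hg : g ∈ closedForms N) :
    (fun α => f α - g α) ∈ closedForms N := sub_mem hf hg

theorem mul_fun_mem (hf : f ∈ closedForms N) (hg : g ∈ closedForms N) :
    (fun α => f α * g α) ∈ closedForms N := mul_mem hf hg

theorem pow_fun_mem (hf : f ∈ closedForms N) (n : ℕ) :
    (fun α => f α ^ n) ∈ closedForms N := pow_mem hf n

theorem ofNat_mul_mem (n : ℕ) [n.AtLeastTwo] (hf : f ∈ closedForms N) :
    (fun α => (OfNat.ofNat n : ℝ) * f α) ∈ closedForms N := by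
  simpa using mul_fun_mem (const_mem N (OfNat.ofNat n)) hf

theorem div_natCast_mem (hf : f ∈ closedForms N) (j : ℕ) :
    (fun α => f α / ((j : ℝ) + 1)) ∈ closedForms N := by
  simpa [div_eq_mul_inv] using mul_fun_mem hf (const_mem N (((j : ℚ) + 1)⁻¹))

theorem sum_fun_mem {ι : Type*} {s : Finset ι} {F : ι → ℝ → ℝ}
    (hF : ∀ i ∈ s, F i ∈ closedForms N) : (fun α => ∑ i ∈ s, F i α) ∈ closedForms N := by
  rw [← Finset.sum_fn]
  exact sum_mem hF

theorem div_sub_mem (hf : f ∈ closedForms N) {i : ℕ} (hi : i < N) :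
    (fun α => f α / (α - i)) ∈ closedForms N := by
  simp only [div_eq_mul_one_div (f _)]
  exact mul_fun_mem hf (Algebra.subset_adjoin (Or.inl (Or.inl (Or.inr ⟨i, hi, rfl⟩))))

theorem shiftedHarmonic_mem {s i : ℕ} (hs : 1 ≤ s) (hi : i ≤ N) :
    (fun α => H s (α - i)) ∈ closedForms N :=
  Algebra.subset_adjoin (Or.inl (Or.inr ⟨s, i, hs, hi, rfl⟩))

theorem zetaValue_mem (N : ℕ) {s : ℕ} (hs : 2 ≤ s) : (fun _ => zetaValue s) ∈ closedForms N :=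
  Algebra.subset_adjoin (Or.inr ⟨s, hs, rfl⟩)

theorem reciprocalSum_mem (m : ℕ) {i : ℕ} (hi : i < N) :
    (fun α => reciprocalSum m (α - i)) ∈ closedForms N := by
  induction m with
  | zero => simpa [reciprocalSum] using const_mem N 0
  | succ m ih =>
    obtain _ | m := m
    · exact div_sub_mem (shiftedHarmonic_mem le_rfl hi.le) hi
    · exact div_sub_mem (sub_fun_mem ih (sub_fun_mem (zetaValue_mem N (by omega))
        (shiftedHarmonic_mem (by omega) hi.le))) hi

theorem secondBell_mem {i : ℕ} (hi : i ≤ N) :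
    (fun α => H 1 (α - i) ^ 2 + H 2 (α - i)) ∈ closedForms N :=
  add_fun_mem (pow_fun_mem (shiftedHarmonic_mem le_rfl hi) 2) (shiftedHarmonic_mem one_le_two hi)

theorem thirdBell_mem {i : ℕ} (hi : i ≤ N) :
    (fun α => H 1 (α - i) ^ 3 + 3 * (H 1 (α - i) * H 2 (α - i)) + 2 * H 3 (α - i)) ∈
      closedForms N :=
  add_fun_mem (add_fun_mem (pow_fun_mem (shiftedHarmonic_mem le_rfl hi) 3)
    (ofNat_mul_mem 3 (mul_fun_mem (shiftedHarmonic_mem le_rfl hi)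
      (shiftedHarmonic_mem one_le_two hi)))) (ofNat_mul_mem 2 (shiftedHarmonic_mem (by norm_num) hi))

theorem mixedSum_mem {i : ℕ} (hi : i < N) : (fun α => mixedSum (α - i)) ∈ closedForms N :=
  div_sub_mem (add_fun_mem (sub_fun_mem (sub_fun_mem (add_fun_mem
    (ofNat_mul_mem 2 (mul_fun_mem (shiftedHarmonic_mem le_rfl hi.le)
      (shiftedHarmonic_mem one_le_two hi.le)))
    (ofNat_mul_mem 2 (shiftedHarmonic_mem (by norm_num) hi.le)))
    (mul_fun_mem (zetaValue_mem N le_rfl) (shiftedHarmonic_mem le_rfl hi.le)))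
    (ofNat_mul_mem 2 (zetaValue_mem N (by norm_num))))
    (div_sub_mem (secondBell_mem hi.le) hi)) hi

theorem quarticPart_mem {i : ℕ} (hi : i ≤ N) : (fun α => quarticPart (α - i)) ∈ closedForms N := by
  have h1 := shiftedHarmonic_mem (s := 1) le_rfl hi
  have h2 := shiftedHarmonic_mem (s := 2) one_le_two hi
  have h3 := shiftedHarmonic_mem (s := 3) (by norm_num) hi
  exact sub_fun_mem (sub_fun_mem (add_fun_mem (add_fun_mem
    (ofNat_mul_mem 3 (mul_fun_mem (pow_fun_mem h1 2) h2)) (ofNat_mul_mem 2 (mul_fun_mem h1 h3)))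
    (pow_fun_mem h2 2))
    (mul_fun_mem (zetaValue_mem N le_rfl) (sub_fun_mem (pow_fun_mem h1 2) h2)))
    (mul_fun_mem (ofNat_mul_mem 2 (zetaValue_mem N (by norm_num))) h1)

theorem exists_hasSum_of_lt {k r : ℕ} (hrk : r < k) {g W : ℝ → ℝ} (hg : LogBounded g)
    (hgm : ∀ i ≤ k, (fun α => g (α - i)) ∈ closedForms k)
    (hWm : ∀ i < k, (fun α => W (α - i)) ∈ closedForms k)
    (hW : ∀ b : ℝ, 0 < b →
      HasSum (fun n : ℕ => (g (n + 1 + b) - g (n + b)) / ((n : ℝ) + 1)) (W b)) :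
    ∃ F ∈ closedForms k, ∀ α : ℝ, (k : ℝ) < α →
      HasSum (fun n : ℕ => g (((n + 1 : ℕ) : ℝ) + α) /
        ((((n + 1 : ℕ) : ℝ) + r) * (((n + 1 : ℕ) : ℝ) + k))) (F α) := by
  -- The factor 1/(k - r) comes from partial fractions; each summand is the value given by summation
  -- by parts for one i.
  refine ⟨fun α => (((k : ℚ) - r)⁻¹ : ℚ) * ∑ i ∈ Finset.Ico r k, (W (α - i) -
    ∑ j ∈ Finset.range i, (g (j + 1 + (α - i)) - g (j + (α - i))) / ((j : ℝ) + 1) +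
      g α / ((i : ℝ) + 1)), ?_, fun α hα => ?_⟩
  · refine mul_fun_mem (const_mem k _) (sum_fun_mem fun i hi => ?_)
    have hi := (Finset.mem_Ico.1 hi).2
    refine add_fun_mem (sub_fun_mem (hWm i hi) (sum_fun_mem fun j hj => ?_))
      (div_natCast_mem (by simpa using hgm 0 (Nat.zero_le k)) i)
    have hj := Finset.mem_range.1 hj
    refine div_natCast_mem (sub_fun_mem ?_ ?_) j
    -- The argument j + 1 + (α - i) is α minus the natural number i - (j + 1); the subtraction is
    -- not truncated because j < i.
    · convert hgm (i - (j + 1)) (by omega) using 3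
      rw [Nat.cast_sub hj]
      push_cast
      ring
    · convert hgm (i - j) (by omega) using 3
      rw [Nat.cast_sub hj.le]
      ring
  · have hα0 : 0 ≤ α := k.cast_nonneg.trans hα.le
    have h1 := hasSum_sum fun i (hi : i ∈ Finset.Ico r k) =>
      hg.hasSum_mul_sub_succ (i := i) hα0 (hW (α - i) (by
        have : (i : ℝ) < k := by exact_mod_cast (Finset.mem_Ico.1 hi).2
        linarith))
    refine (h1.mul_left _).congr_fun fun n => ?_
    have h2 : ((k : ℝ) - r) ≠ 0 := by
      have : (r : ℝ) < k := by exact_mod_cast hrk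
      exact (sub_pos.2 this).ne'
    rw [← Finset.mul_sum]
    -- The differences of consecutive reciprocals telescope from r to k.
    have h3 := Finset.sum_Ico_sub (fun i : ℕ => -(1 / ((n : ℝ) + 1 + i))) hrk.le
    have h4 : ∑ i ∈ Finset.Ico r k, (1 / ((n : ℝ) + 1 + i) - 1 / ((n : ℝ) + 1 + i + 1)) =
        1 / ((n : ℝ) + 1 + r) - 1 / ((n : ℝ) + 1 + k) := by
      rw [neg_sub_neg] at h3
      rw [← h3]
      refine Finset.sum_congr rfl fun i _ => ?_
      push_cast
      ring
    rw [h4]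
    push_cast
    field_simp
    ring

theorem exists_hasSum {k r : ℕ} (hkr : k ≠ r) {g W : ℝ → ℝ} (hg : LogBounded g)
    (hgm : ∀ N i : ℕ, i ≤ N → (fun α => g (α - i)) ∈ closedForms N)
    (hWm : ∀ N i : ℕ, i < N → (fun α => W (α - i)) ∈ closedForms N)
    (hW : ∀ b : ℝ, 0 < b →
      HasSum (fun n : ℕ => (g (n + 1 + b) - g (n + b)) / ((n : ℝ) + 1)) (W b)) :
    ∃ F ∈ closedForms (max k r), ∀ α : ℝ, ((max k r : ℕ) : ℝ) < α →
      HasSum (fun n : ℕ => g (((n + 1 : ℕ) : ℝ) + α) /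
        ((((n + 1 : ℕ) : ℝ) + r) * (((n + 1 : ℕ) : ℝ) + k))) (F α) := by
  rcases hkr.lt_or_gt with h | h
  · rw [max_eq_right h.le]
    simpa only [mul_comm] using exists_hasSum_of_lt h hg (hgm r) (hWm r) hW
  · rw [max_eq_left h.le]
    exact exists_hasSum_of_lt h hg (hgm k) (hWm k) hW

end closedForms

theorem theorem2p9 (k r : ℕ) (hk : 1 ≤ k) (hr : 1 ≤ r) (hkr : k ≠ r) :
    (∀ m : ℕ, 1 ≤ m → ∃ F ∈ closedForms (max k r), ∀ α : ℝ, ((max k r : ℕ) : ℝ) < α →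
      HasSum (fun n : ℕ => shiftedHarmonic m (((n + 1 : ℕ) : ℝ) + α) /
        ((((n + 1 : ℕ) : ℝ) + r) * (((n + 1 : ℕ) : ℝ) + k))) (F α)) ∧
    (∃ F ∈ closedForms (max k r), ∀ α : ℝ, ((max k r : ℕ) : ℝ) < α →
      HasSum (fun n : ℕ => shiftedHarmonic 1 (((n + 1 : ℕ) : ℝ) + α) *
          shiftedHarmonic 2 (((n + 1 : ℕ) : ℝ) + α) /
        ((((n + 1 : ℕ) : ℝ) + r) * (((n + 1 : ℕ) : ℝ) + k))) (F α)) ∧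
    (∃ F ∈ closedForms (max k r), ∀ α : ℝ, ((max k r : ℕ) : ℝ) < α →
      HasSum (fun n : ℕ => shiftedHarmonic 1 (((n + 1 : ℕ) : ℝ) + α) ^ 3 /
        ((((n + 1 : ℕ) : ℝ) + r) * (((n + 1 : ℕ) : ℝ) + k))) (F α)) ∧
    (∃ F ∈ closedForms (max k r), ∀ α : ℝ, ((max k r : ℕ) : ℝ) < α →
      HasSum (fun n : ℕ => shiftedHarmonic 1 (((n + 1 : ℕ) : ℝ) + α) ^ 2 *
          shiftedHarmonic 2 (((n + 1 : ℕ) : ℝ) + α) /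
        ((((n + 1 : ℕ) : ℝ) + r) * (((n + 1 : ℕ) : ℝ) + k))) (F α)) := by
  have hH := LogBounded.shiftedHarmonic (s := 1) le_rfl
  have hH2 := LogBounded.shiftedHarmonic (s := 2) one_le_two
  have h1 : ∀ N i : ℕ, i ≤ N → (fun α => shiftedHarmonic 1 (α - i)) ∈ closedForms N :=
    fun N i hi => closedForms.shiftedHarmonic_mem le_rfl hi
  have h2 : ∀ N i : ℕ, i ≤ N → (fun α => shiftedHarmonic 2 (α - i)) ∈ closedForms N :=
    fun N i hi => closedForms.shiftedHarmonic_mem one_le_two hi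
  refine ⟨fun m hm => ?_, ?_, ?_, ?_⟩
  · exact closedForms.exists_hasSum hkr (.shiftedHarmonic hm)
      (fun N i hi => closedForms.shiftedHarmonic_mem hm hi)
      (fun N i hi => closedForms.reciprocalSum_mem m hi)
      (fun b hb => hasSum_increment_shiftedHarmonic hm hb)
  · exact closedForms.exists_hasSum (g := fun x => shiftedHarmonic 1 x * shiftedHarmonic 2 x)
      (W := fun b => mixedSum b - reciprocalSum 3 b) hkr
      (hH.mul hH2)
      (fun N i hi => closedForms.mul_fun_mem (h1 N i hi) (h2 N i hi))
      (fun N i hi => closedForms.sub_fun_mem (closedForms.mixedSum_mem hi)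
        (closedForms.reciprocalSum_mem 3 hi))
      (fun b hb => hasSum_increment_one_mul_two hb)
  · exact closedForms.exists_hasSum (g := fun x => shiftedHarmonic 1 x ^ 3) (W := fun b =>
        3 * ((shiftedHarmonic 1 b ^ 3 + 3 * (shiftedHarmonic 1 b * shiftedHarmonic 2 b) +
          2 * shiftedHarmonic 3 b) / b) - 3 * mixedSum b + reciprocalSum 3 b) hkr (hH.pow 3)
      (fun N i hi => closedForms.pow_fun_mem (h1 N i hi) 3)
      (fun N i hi => closedForms.add_fun_mem (closedForms.sub_fun_mem
        (closedForms.ofNat_mul_mem 3 (closedForms.div_sub_mem (closedForms.thirdBell_mem hi.le) hi))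
        (closedForms.ofNat_mul_mem 3 (closedForms.mixedSum_mem hi)))
        (closedForms.reciprocalSum_mem 3 hi))
      (fun b hb => hasSum_increment_one_cube hb)
  · exact closedForms.exists_hasSum (g := fun x => shiftedHarmonic 1 x ^ 2 * shiftedHarmonic 2 x)
      (W := fun b =>
        (quarticPart b + (shiftedHarmonic 1 b ^ 3 + 3 * (shiftedHarmonic 1 b * shiftedHarmonic 2 b) +
          2 * shiftedHarmonic 3 b) / b - 2 * mixedSum b) / b + reciprocalSum 4 b) hkr
      ((hH.pow 2).mul hH2)
      (fun N i hi => closedForms.mul_fun_mem (closedForms.pow_fun_mem (h1 N i hi) 2) (h2 N i hi))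
      (fun N i hi => closedForms.add_fun_mem (closedForms.div_sub_mem (closedForms.sub_fun_mem
        (closedForms.add_fun_mem (closedForms.quarticPart_mem hi.le)
          (closedForms.div_sub_mem (closedForms.thirdBell_mem hi.le) hi))
        (closedForms.ofNat_mul_mem 2 (closedForms.mixedSum_mem hi))) hi)
        (closedForms.reciprocalSum_mem 4 hi))
      (fun b hb => hasSum_increment_one_sq_mul_two hb)
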